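/- Let $\Gamma$ be a totally ordered abelian group with positive cone $\Gamma^+=\{x\in\Gamma: x\ge 0\}$, let $\mathcal A$ be a unital $C^*$-algebra, and let $\alpha:\Gamma^+\to\mathrm{End}(\mathcal A)$ be an action by (not necessarily unital) $*$-endomorphisms: $\alpha_0=\mathrm{Id}$ and $\alpha_x\circ\alpha_y=\alpha_{x+y}$. Assume that $(\mathcal A,\Gamma^+,\alpha)$ is finely representable: there are a Hilbert space $K$, a faithful non-degenerate representation $\sigma:\mathcal A\to L(K)$ and a semigroup homomorphism $V:\Gamma^+\to L(K)$ such that, for all $a\in\mathcal A$ and $x\in\Gamma^+$, $$\sigma(\alpha_x(a))=V_x\sigma(a)V_x^*,\qquad V_x^*\sigma(a)V_x\in\sigma(\mathcal A),\qquad V_x\sigma(a)=\sigma(\alpha_x(a))V_x .$$ Let $L$ be the complete transfer action, i.e. the unique family $(L_x)_{x\in\Gamma^+}$ of continuous positive linear maps on $\mathcal A$ with $L_{x+y}=L_y\circ L_x$, $L_x(\alpha_x(a)b)=aL_x(b)$ and $\alpha_x(L_x(a))=\alpha_x(1)a\alpha_x(1)$. Let $l_1(\Gamma,\alpha,\mathcal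 A)$ be the Banach $*$-algebra of families $a=(a_g)_{g\in\Gamma}$ with $a_x\in\mathcal A\alpha_x(1)$ and $a_{-x}\in\alpha_x(1)\mathcal A$ for $x\ge 0$ and $\|a\|=\sum_g\|a_g\|<\infty$, with coordinatewise linear operations, involution $(a^*)_g=(a_{-g})^*$ and product $$(a\cdot b)_g=\begin{cases}\displaystyle\sum_{g=x-y;\ x,y>0}a_x\alpha_{x-y}(b_{-y})+\sum_{g=y-x;\ x,y>0}L_x(a_{-x}b_y)+\sum_{g=x+y;\ x,y\ge 0}a_x\alpha_x(b_y), & g\ge 0,\\ \displaystyle\sum_{g=x-y;\ x,y>0}\alpha_{y-x}(a_x)b_{-y}+\sum_{g=y-x;\ x,y>0}L_y(a_{-x}b_y)+\sum_{g=-x-y;\ x,y\ge 0}\alpha_y(a_{-x})b_{-y}, & g<0.\end{cases}$$ The crossed product $\mathcal A\rtimes_\alpha\Gamma$ is the enveloping $C^*$-algebra of $l_1(\Gamma,\alpha,\mathcal A)$. A covariant representation of $(\mathcal A,\Gamma^+,\alpha)$ on a Hilbert space $H$ is a pair $(\pi,U)$ of a non-degenerate representation $\pi:\mathcal A\to L(H)$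 and a semigroup homomorphism $U:\Gamma^+\to L(H)$ with $$U_x\pi(a)U_x^*=\pi(\alpha_x(a)),\qquad U_x^*\pi(a)U_x=\pi(L_x(a))\qquad(a\in\mathcal A,\ x\in\Gamma^+).$$ Then for every Hilbert space $H$ the following holds. For each covariant representation $(\pi,U)$ on $H$ there is a unique representation $\pi\times U$ of $\mathcal A\rtimes_\alpha\Gamma$ on $H$ that is given on the image of $a\in l_1(\Gamma,\alpha,\mathcal A)$ by the norm convergent sum $$(\pi\times U)(a)=\sum_{x>0}U_x^*\pi(a_{-x})+\pi(a_0)+\sum_{x>0}\pi(a_x)U_x ,$$ and $(\pi,U)\mapsto\pi\times U$ is a bijection from the covariant representations of $(\mathcal A,\Gamma^+,\alpha)$ on $H$ onto the non-degenerate representations of $\mathcal A\rtimes_\alpha\Gamma$ on $H$. -/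

import Mathlib

/-- The positive cone of an ordered abelian group. -/
abbrev PosCone (Γ : Type*) [AddCommGroup Γ] [LinearOrder Γ] : Type _ := {x : Γ // 0 ≤ x}

/-- A representation on a Hilbert space is non-degenerate if the vectors `ρ b ξ` span a dense
subspace. -/
def IsNondegenerate {B H : Type*} [NonUnitalSemiring B] [Star B] [Module ℂ B]
    [NormedAddCommGroup H] [InnerProductSpace ℂ H] [CompleteSpace H]
    (ρ : B →⋆ₙₐ[ℂ] (H →L[ℂ] H)) : Prop :=
  (Submodule.span ℂ {η : H | ∃ (b : B) (ξ : H), ρ b ξ = η}).topologicalClosure = ⊤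

section System

variable (Γ A : Type*) [AddCommGroup Γ] [LinearOrder Γ] [IsOrderedAddMonoid Γ] [CStarAlgebra A]

/-- An action of the positive cone `Γ⁺` on the unital C⋆-algebra `A` by (not necessarily unital)
⋆-endomorphisms: a C⋆-dynamical system `(A, Γ⁺, α)`. -/
structure EndAction where
  toFun : PosCone Γ → (A →⋆ₙₐ[ℂ] A)
  map_zero' : toFun 0 = NonUnitalStarAlgHom.id ℂ A
  map_add' : ∀ x y, toFun (x + y) = (toFun x).comp (toFun y)

end System

section Main

variable {Γ A : Type*} [AddCommGroup Γ] [LinearOrder Γ] [IsOrderedAddMonoid Γ] [CStarAlgebra A]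

instance : CoeFun (EndAction Γ A) (fun _ => PosCone Γ → (A →⋆ₙₐ[ℂ] A)) := ⟨EndAction.toFun⟩

/-- The conditions on a triple `(H, π, U)` in the definition of a finely representable system. -/
structure IsFineRepresentation (α : EndAction Γ A) {H : Type*} [NormedAddCommGroup H]
    [InnerProductSpace ℂ H] [CompleteSpace H]
    (π : A →⋆ₙₐ[ℂ] (H →L[ℂ] H)) (U : PosCone Γ → (H →L[ℂ] H)) : Prop where
  faithful : Function.Injective π
  nondegenerate : IsNondegenerate π
  add : ∀ x y, U (x + y) = U x * U y
  implements : ∀ x a, π (α x a) = U x * π a * star (U x)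
  star_mem_range : ∀ x a, star (U x) * π a * U x ∈ Set.range π
  intertwines : ∀ x a, U x * π a = π (α x a) * U x

/-- `(A, Γ⁺, α)` is finely representable. -/
def IsFinelyRepresentable.{w, u, v} {Γ : Type u} {A : Type v} [AddCommGroup Γ] [LinearOrder Γ]
    [IsOrderedAddMonoid Γ] [CStarAlgebra A] (α : EndAction Γ A) : Prop :=
  ∃ (H : Type w) (_ : NormedAddCommGroup H) (_ : InnerProductSpace ℂ H) (_ : CompleteSpace H)
    (π : A →⋆ₙₐ[ℂ] (H →L[ℂ] H)) (U : PosCone Γ → (H →L[ℂ] H)), IsFineRepresentation α π U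

/-- `L` is a complete transfer action for `(A, Γ⁺, α)`: an action by continuous positive linear
maps satisfying the transfer identity and completeness. -/
structure IsCompleteTransferAction (α : EndAction Γ A) (L : PosCone Γ → (A →L[ℂ] A)) : Prop where
  add : ∀ x y a, L (x + y) a = L y (L x a)
  positive : ∀ x a, ∃ b, L x (star a * a) = star b * b
  transfer : ∀ x a b, L x (α x a * b) = a * L x b
  complete : ∀ x a, α x (L x a) = α x 1 * a * α x 1

theorem EndAction.zero_apply (α : EndAction Γ A) (a : A) : α 0 a = a := by
  rw [α.map_zero']; rfl

theorem EndAction.add_apply (α : EndAction Γ A) (x y : PosCone Γ) (a : A) :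
    α (x + y) a = α x (α y a) := by
  rw [α.map_add']; rfl

theorem EndAction.norm_le (α : EndAction Γ A) (x : PosCone Γ) (a : A) : ‖α x a‖ ≤ ‖a‖ :=
  NonUnitalStarAlgHom.norm_apply_le _ _

theorem EndAction.one_mul_apply (α : EndAction Γ A) (x : PosCone Γ) (a : A) :
    α x 1 * α x a = α x a := by rw [← map_mul, one_mul]

theorem EndAction.apply_mul_one (α : EndAction Γ A) (x : PosCone Γ) (a : A) :
    α x a * α x 1 = α x a := by rw [← map_mul, mul_one]

theorem IsNondegenerate.map_one {B H : Type*} [Semiring B] [Star B] [Module ℂ B]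
    [NormedAddCommGroup H] [InnerProductSpace ℂ H] [CompleteSpace H]
    {ρ : B →⋆ₙₐ[ℂ] (H →L[ℂ] H)} (h : IsNondegenerate ρ) : ρ 1 = 1 := by
  have h1 : Dense ((Submodule.span ℂ {η : H | ∃ (b : B) (ξ : H), ρ b ξ = η} : Submodule ℂ H) :
      Set H) := by
    rw [Submodule.dense_iff_topologicalClosure_eq_top]; exact h
  refine ContinuousLinearMap.ext_on h1 ?_
  rintro _ ⟨b, ξ, rfl⟩
  rw [← mul_apply_eq_comp, ← map_mul, one_mul]; rfl

theorem exists_star_mul_self_of_injective {B : Type*} [CStarAlgebra B] (π : A →⋆ₐ[ℂ] B)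
    (hπ : Function.Injective π) (a : A) (c : B) (h : π a = star c * c) :
    ∃ b, a = star b * b := by
  let := CStarAlgebra.spectralOrder A
  let := CStarAlgebra.spectralOrderedRing A
  let := CStarAlgebra.spectralOrder B
  let := CStarAlgebra.spectralOrderedRing B
  have hs : IsSelfAdjoint a := by
    apply hπ
    rw [map_star, h]; simp
  have h0 : 0 ≤ a := by
    rw [StarOrderedRing.nonneg_iff_spectrum_nonneg (R := ℝ) a hs, ← hs.map_spectrum_real π hπ]
    exact (StarOrderedRing.nonneg_iff_spectrum_nonneg (R := ℝ) (π a) (hs.map π)).mp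
      (by rw [h]; exact star_mul_self_nonneg c)
  exact CStarAlgebra.nonneg_iff_eq_star_mul_self.mp h0


namespace IsFineRepresentation

variable {α : EndAction Γ A} {H : Type*} [NormedAddCommGroup H]
    [InnerProductSpace ℂ H] [CompleteSpace H]
    {π : A →⋆ₙₐ[ℂ] (H →L[ℂ] H)} {U : PosCone Γ → (H →L[ℂ] H)}

theorem exists_isComplete (h : IsFineRepresentation α π U) :
    ∃ L : PosCone Γ → (A →L[ℂ] A), IsCompleteTransferAction α L ∧
      ∀ x a, star (U x) * π a * U x = π (L x a) := by
  have hone := h.nondegenerate.map_one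
  choose l hl using h.star_mem_range
  have hinj := h.faithful
  have hUU : ∀ x, U x * star (U x) = π (α x 1) := fun x => by
    rw [h.implements, hone, mul_one]
  let L : PosCone Γ → (A →L[ℂ] A) := fun x =>
    LinearMap.mkContinuous
      { toFun := l x
        map_add' := fun a b => hinj (by
          simp only [hl, map_add, mul_add, add_mul])
        map_smul' := fun c a => hinj (by
          simp only [hl, map_smul, RingHom.id_apply, mul_smul_comm, smul_mul_assoc]) }
      (‖star (U x)‖ * ‖U x‖) (fun a => by
        change ‖l x a‖ ≤ _
        rw [← NonUnitalStarAlgHom.norm_map π hinj (l x a), hl]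
        calc ‖star (U x) * π a * U x‖ ≤ ‖star (U x)‖ * ‖π a‖ * ‖U x‖ := norm_mul₃_le
          _ = ‖star (U x)‖ * ‖U x‖ * ‖a‖ := by
            rw [NonUnitalStarAlgHom.norm_map π hinj a]; ring)
  have hL : ∀ x a, π (L x a) = star (U x) * π a * U x := hl
  refine ⟨L, ⟨fun x y a => hinj ?_, fun x a => ?_, fun x a b => hinj ?_, fun x a => hinj ?_⟩,
    fun x a => (hL x a).symm⟩
  · simp only [hL, h.add, star_mul, mul_assoc]
  · refine exists_star_mul_self_of_injective
      ({ π with map_one' := hone, commutes' := fun c => ?_ } : A →⋆ₐ[ℂ] (H →L[ℂ] H)) hinj _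
      (π a * U x) ?_
    · change π (algebraMap ℂ A c) = _
      rw [Algebra.algebraMap_eq_smul_one, map_smul, hone, Algebra.algebraMap_eq_smul_one]
    · change π _ = _
      simp only [hL, map_mul, map_star, star_mul, mul_assoc]
  · have := congrArg star (h.intertwines x (star a))
    simp only [star_mul, map_star, star_star] at this
    rw [hL, map_mul, map_mul, hL, ← mul_assoc, ← this]
    simp only [mul_assoc]
  · rw [h.implements, hL, map_mul, map_mul, ← hUU]
    simp only [mul_assoc]

end IsFineRepresentation

namespace IsCompleteTransferAction

variable {α : EndAction Γ A} {L L' : PosCone Γ → (A →L[ℂ] A)}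

theorem apply_star (h : IsCompleteTransferAction α L) (x : PosCone Γ) (a : A) :
    L x (star a) = star (L x a) := by
  have hp : ∀ b, star (L x (star b * b)) = L x (star b * b) := fun b => by
    obtain ⟨c, hc⟩ := h.positive x b
    rw [hc, star_mul, star_star]
  have key : ∀ a : A, (4 : ℂ) • a = star (a + 1) * (a + 1) - star (a - 1) * (a - 1)
      + Complex.I • (star (a + Complex.I • 1) * (a + Complex.I • 1))
      - Complex.I • (star (a - Complex.I • 1) * (a - Complex.I • 1)) := fun a => by
    simp only [star_add, star_sub, star_smul, star_one, mul_add, add_mul, sub_mul, mul_sub,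
      mul_one, one_mul, smul_mul_assoc, mul_smul_comm, smul_add, smul_sub, smul_smul,
      Complex.star_def, Complex.conj_I, Complex.I_mul_I, neg_smul, one_smul, smul_neg,
      neg_neg, neg_mul]
    module
  have key' : ∀ a : A, (4 : ℂ) • star a = star (a + 1) * (a + 1) - star (a - 1) * (a - 1)
      - Complex.I • (star (a + Complex.I • 1) * (a + Complex.I • 1))
      + Complex.I • (star (a - Complex.I • 1) * (a - Complex.I • 1)) := fun a => by
    simp only [star_add, star_sub, star_smul, star_one, mul_add, add_mul, sub_mul, mul_sub,
      mul_one, one_mul, smul_mul_assoc, mul_smul_comm, smul_add, smul_sub, smul_smul,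
      Complex.star_def, Complex.conj_I, Complex.I_mul_I, neg_smul, one_smul, smul_neg,
      neg_neg, neg_mul]
    module
  have h4 : (4 : ℂ) ≠ 0 := by norm_num
  apply smul_right_injective A h4
  simp only
  have e1 : (4 : ℂ) • star (L x a) = star (L x ((4 : ℂ) • a)) := by
    rw [map_smul, star_smul]; simp
  rw [e1, ← map_smul, key a, key' a]
  have p1 := hp (a + 1)
  have p2 := hp (a - 1)
  have p3 := hp (a + Complex.I • 1)
  have p4 := hp (a - Complex.I • 1)
  generalize star (a + 1) * (a + 1) = q1 at *
  generalize star (a - 1) * (a - 1) = q2 at *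
  generalize star (a + Complex.I • 1) * (a + Complex.I • 1) = q3 at *
  generalize star (a - Complex.I • 1) * (a - Complex.I • 1) = q4 at *
  simp only [map_add, map_sub, map_smul, star_add, star_sub, star_smul, p1, p2, p3, p4,
    Complex.star_def, Complex.conj_I, neg_smul]
  module

theorem apply_one_mul (h : IsCompleteTransferAction α L) (x : PosCone Γ) (a : A) :
    L x (α x 1 * a) = L x a := by rw [h.transfer, one_mul]

theorem transfer' (h : IsCompleteTransferAction α L) (x : PosCone Γ) (a b : A) :
    L x (b * α x a) = L x b * a := by
  have := h.transfer x (star a) (star b)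
  rw [map_star, ← star_mul, h.apply_star, h.apply_star, ← star_mul] at this
  exact star_injective this

theorem apply_mul_one (h : IsCompleteTransferAction α L) (x : PosCone Γ) (a : A) :
    L x (a * α x 1) = L x a := by rw [h.transfer', mul_one]

theorem unique (h : IsCompleteTransferAction α L) (h' : IsCompleteTransferAction α L') :
    L = L' := by
  have key : ∀ {M M' : PosCone Γ → (A →L[ℂ] A)}, IsCompleteTransferAction α M →
      IsCompleteTransferAction α M' → ∀ x a, M x a = M' x a * M x 1 := by
    intro M M' hM hM' x a
    rw [← hM.apply_one_mul, ← hM.apply_mul_one, ← hM'.complete,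
      ← mul_one (α x (M' x a)), hM.transfer]
  have hs : ∀ {M : PosCone Γ → (A →L[ℂ] A)}, IsCompleteTransferAction α M →
      ∀ x, star (M x 1) = M x 1 := fun hM x => by rw [← hM.apply_star, star_one]
  have h1 : ∀ x, L x 1 = L' x 1 := fun x => by
    have a1 := congrArg star (key h h' x 1)
    rw [star_mul, hs h, hs h'] at a1
    rw [a1]; exact (key h' h x 1).symm
  funext x
  ext a
  rw [key h h' x a, h1 x, ← key h' h' x a]

end IsCompleteTransferAction

theorem IsFinelyRepresentable.existsUnique_isComplete {α : EndAction Γ A}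
    (hα : IsFinelyRepresentable α) :
    ∃! L : PosCone Γ → (A →L[ℂ] A), IsCompleteTransferAction α L := by
  obtain ⟨H, _, _, _, π, U, h⟩ := hα
  obtain ⟨L, hL, -⟩ := h.exists_isComplete
  exact ⟨L, hL, fun L' hL' => hL'.unique hL⟩

/-- The unique complete transfer action of a finely representable system. -/
noncomputable def IsFinelyRepresentable.transfer {α : EndAction Γ A}
    (hα : IsFinelyRepresentable α) : PosCone Γ → (A →L[ℂ] A) :=
  hα.existsUnique_isComplete.choose

theorem IsFinelyRepresentable.isComplete_transfer {α : EndAction Γ A}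
    (hα : IsFinelyRepresentable α) : IsCompleteTransferAction α hα.transfer :=
  hα.existsUnique_isComplete.choose_spec.1

/-- `(H, π, U)` is a covariant representation of `(A, Γ⁺, α)`, where `L` is the transfer action. -/
structure IsCovariant (α : EndAction Γ A) (L : PosCone Γ → (A →L[ℂ] A)) {H : Type*}
    [NormedAddCommGroup H] [InnerProductSpace ℂ H] [CompleteSpace H]
    (π : A →⋆ₙₐ[ℂ] (H →L[ℂ] H)) (U : PosCone Γ → (H →L[ℂ] H)) : Prop where
  nondegenerate : IsNondegenerate π
  add : ∀ x y, U (x + y) = U x * U y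
  conj : ∀ x a, U x * π a * star (U x) = π (α x a)
  star_conj : ∀ x a, star (U x) * π a * U x = π (L x a)

theorem IsFineRepresentation.isCovariant {α : EndAction Γ A} {L : PosCone Γ → (A →L[ℂ] A)}
    (hL : IsCompleteTransferAction α L) {H : Type*} [NormedAddCommGroup H]
    [InnerProductSpace ℂ H] [CompleteSpace H]
    {π : A →⋆ₙₐ[ℂ] (H →L[ℂ] H)} {U : PosCone Γ → (H →L[ℂ] H)}
    (h : IsFineRepresentation α π U) : IsCovariant α L π U := by
  obtain ⟨L', hL', hLU⟩ := h.exists_isComplete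
  obtain rfl := hL.unique hL'
  exact ⟨h.nondegenerate, h.add, fun x a => (h.implements x a).symm, hLU⟩

/-- The operator `π(a) U_g` for `g ≥ 0` and `U_{-g}^* π(a)` for `g < 0`. -/
noncomputable def homogeneousTerm {H : Type*} [NormedAddCommGroup H]
    [InnerProductSpace ℂ H] [CompleteSpace H] (π : A →⋆ₙₐ[ℂ] (H →L[ℂ] H))
    (U : PosCone Γ → (H →L[ℂ] H)) (g : Γ) (a : A) : H →L[ℂ] H :=
  if 0 ≤ g then π a * U (Nonneg.toNonneg g) else star (U (Nonneg.toNonneg (-g))) * π a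

/-- The space of admissible coefficients in degree `g`: it is `A α_g(1)` if `g ≥ 0` and
`α_{-g}(1) A` if `g < 0`. -/
noncomputable def coeffSpace (α : EndAction Γ A) (g : Γ) : Submodule ℂ A :=
  if 0 ≤ g then LinearMap.range (LinearMap.mulRight ℂ (α (Nonneg.toNonneg g) 1))
  else LinearMap.range (LinearMap.mulLeft ℂ (α (Nonneg.toNonneg (-g)) 1))

/-- The coefficient of the product `a δ_h · b δ_k`, which lives in degree `g = h + k`. For
`x, y ≥ 0` it is
* `a α_x(b)` if `h = x` and `k = y`,
* `α_y(a) b` if `h = -x` and `k = -y`,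
* `a α_{x-y}(b)` or `α_{y-x}(a) b` if `h = x`, `k = -y` and `g ≥ 0` or `g < 0`, respectively,
* `L_x(a b)` or `L_y(a b)` if `h = -x`, `k = y` and `g ≥ 0` or `g < 0`, respectively.
Here `toNonneg g` is `g` as an element of `Γ⁺` whenever `g ≥ 0`. -/
noncomputable def mulCoeff (α : EndAction Γ A) (L : PosCone Γ → (A →L[ℂ] A)) (h k : Γ)
    (a b : A) : A :=
  if 0 ≤ h then
    if 0 ≤ k then a * α (Nonneg.toNonneg h) b
    else if 0 ≤ h + k then a * α (Nonneg.toNonneg (h + k)) b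
    else α (Nonneg.toNonneg (-(h + k))) a * b
  else
    if k ≤ 0 then α (Nonneg.toNonneg (-k)) a * b
    else if 0 ≤ h + k then L (Nonneg.toNonneg (-h)) (a * b)
    else L (Nonneg.toNonneg k) (a * b)

section Coeff

open Nonneg

theorem toNonneg_eq_zero {Γ : Type*} [AddCommGroup Γ] [LinearOrder Γ] {g : Γ} (h : g ≤ 0) : toNonneg g = 0 := by
  ext; simp [toNonneg, h]

theorem mem_coeffSpace_iff (α : EndAction Γ A) (g : Γ) (a : A) :
    a ∈ coeffSpace α g ↔ α (toNonneg (-g)) 1 * a = a ∧ a * α (toNonneg g) 1 = a := by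
  unfold coeffSpace
  split_ifs with hg
  · rw [toNonneg_eq_zero (neg_nonpos.mpr hg), α.zero_apply]
    simp only [one_mul, true_and, LinearMap.mem_range, LinearMap.mulRight_apply]
    constructor
    · rintro ⟨c, rfl⟩
      rw [mul_assoc, α.one_mul_apply]
    · exact fun h => ⟨a, h⟩
  · rw [toNonneg_eq_zero (not_le.mp hg).le, α.zero_apply]
    simp only [mul_one, and_true, LinearMap.mem_range, LinearMap.mulLeft_apply]
    constructor
    · rintro ⟨c, rfl⟩
      rw [← mul_assoc, α.one_mul_apply]
    · exact fun h => ⟨a, h⟩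

namespace IsCovariant

variable {α : EndAction Γ A} {L : PosCone Γ → (A →L[ℂ] A)} {H : Type*}
    [NormedAddCommGroup H] [InnerProductSpace ℂ H] [CompleteSpace H]
    {π : A →⋆ₙₐ[ℂ] (H →L[ℂ] H)} {U : PosCone Γ → (H →L[ℂ] H)}

theorem mul_star (h : IsCovariant α L π U) (x : PosCone Γ) : U x * star (U x) = π (α x 1) := by
  rw [← h.conj, h.nondegenerate.map_one, mul_one]

theorem zero (h : IsCovariant α L π U) : U 0 = 1 := by
  have h1 := h.mul_star 0
  rw [α.zero_apply, h.nondegenerate.map_one] at h1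
  have h2 := h.add 0 0
  rw [add_zero] at h2
  calc U 0 = U 0 * (U 0 * star (U 0)) := by rw [h1, mul_one]
    _ = 1 := by rw [← mul_assoc, ← h2, h1]

theorem star_mul_apply (h : IsCovariant α L π U) (hL : IsCompleteTransferAction α L)
    (x : PosCone Γ) (a : A) : star (U x) * π (α x a) = π a * star (U x) := by
  have h1 : star (U x) * π (α x a) = star (U x) * π (α x a) * U x * star (U x) := by
    rw [mul_assoc _ (U x), h.mul_star, mul_assoc, ← map_mul, α.apply_mul_one]
  have h2 : star (U x) * U x = π (L x 1) := by
    rw [← h.star_conj, h.nondegenerate.map_one, mul_one]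
  rw [h1, h.star_conj, ← mul_one (α x a), hL.transfer, map_mul, ← h2, mul_assoc, mul_assoc,
    h.mul_star]
  have h3 := congrArg star (h.mul_star x)
  have h4 : star (U x) * π (α x 1) = star (U x) := by
    have e : (1 - U x * star (U x)) * U x = 0 := by
      have hp : π (α x 1) * π (α x 1) = π (α x 1) := by
        rw [← map_mul, α.apply_mul_one]
      rw [← CStarRing.mul_star_self_eq_zero_iff]
      rw [h.mul_star, star_mul, star_sub, star_one, ← map_star, ← map_star, star_one]
      have : U x * (star (U x) * (1 - π (α x 1))) = 0 := by
        rw [← mul_assoc, h.mul_star, mul_sub, mul_one, hp, sub_self]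
      rw [mul_assoc, this, mul_zero]
    have e2 := congrArg star e
    rw [star_mul, star_sub, h.mul_star, star_zero, ← map_star, ← map_star, star_one, star_one,
      mul_sub, mul_one, sub_eq_zero] at e2
    exact e2.symm
  rw [h4]

theorem mul_apply (h : IsCovariant α L π U) (hL : IsCompleteTransferAction α L)
    (x : PosCone Γ) (a : A) : U x * π a = π (α x a) * U x := by
  have := congrArg star (h.star_mul_apply hL x (star a))
  simp only [star_mul, map_star, star_star] at this
  exact this.symm

theorem term_eq (h : IsCovariant α L π U) (g : Γ) (a : A) :
    homogeneousTerm π U g a = star (U (toNonneg (-g))) * π a * U (toNonneg g) := by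
  unfold homogeneousTerm
  split_ifs with hg
  · rw [toNonneg_eq_zero (neg_nonpos.mpr hg), h.zero, star_one, one_mul]
  · rw [toNonneg_eq_zero (not_le.mp hg).le, h.zero, mul_one]

theorem term_star (h : IsCovariant α L π U) (g : Γ) (a : A) :
    homogeneousTerm π U (-g) (star a) = star (homogeneousTerm π U g a) := by
  rw [h.term_eq, h.term_eq, neg_neg]
  simp only [star_mul, map_star, star_star, mul_assoc]

theorem eq_of_term_eq (h : IsCovariant α L π U) (hπ : Function.Injective π) (g : Γ) {a b : A}
    (ha : a ∈ coeffSpace α g) (hb : b ∈ coeffSpace α g)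
    (hab : homogeneousTerm π U g a = homogeneousTerm π U g b) : a = b := by
  have key : ∀ c ∈ coeffSpace α g, U (toNonneg (-g)) * homogeneousTerm π U g c *
      star (U (toNonneg g)) = π c := by
    intro c hc
    rw [mem_coeffSpace_iff] at hc
    rw [h.term_eq]
    calc _ = (U (toNonneg (-g)) * star (U (toNonneg (-g)))) * π c *
          (U (toNonneg g) * star (U (toNonneg g))) := by simp only [mul_assoc]
      _ = π c := by rw [h.mul_star, h.mul_star, ← map_mul, ← map_mul, hc.1, hc.2]
  exact hπ (by rw [← key a ha, ← key b hb, hab])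

theorem term_pos (_h : IsCovariant α L π U) (x : PosCone Γ) (a : A) :
    homogeneousTerm π U (x : Γ) a = π a * U x := by
  unfold homogeneousTerm
  rw [if_pos x.2, toNonneg_coe]

theorem term_neg (h : IsCovariant α L π U) (x : PosCone Γ) (a : A) :
    homogeneousTerm π U (-(x : Γ)) a = star (U x) * π a := by
  rw [h.term_eq, neg_neg, toNonneg_coe, toNonneg_eq_zero (neg_nonpos.mpr x.2), h.zero, mul_one]

theorem term_mul (h : IsCovariant α L π U) (hL : IsCompleteTransferAction α L) (g k : Γ)
    {a b : A} (ha : a ∈ coeffSpace α g) (hb : b ∈ coeffSpace α k) :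
    homogeneousTerm π U (g + k) (mulCoeff α L g k a b) =
      homogeneousTerm π U g a * homogeneousTerm π U k b := by
  rw [mem_coeffSpace_iff] at ha hb
  have hex : ∀ {g : Γ}, 0 ≤ g → ∃ x : PosCone Γ, g = x := fun {g} hg => ⟨⟨g, hg⟩, rfl⟩
  have hexn : ∀ {g : Γ}, g ≤ 0 → ∃ x : PosCone Γ, g = -(x : Γ) :=
    fun {g} hg => ⟨⟨-g, neg_nonneg.mpr hg⟩, (neg_neg g).symm⟩
  unfold mulCoeff
  split_ifs with h1 h2 h3 h4 h5
  · obtain ⟨x, rfl⟩ := hex h1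
    obtain ⟨y, rfl⟩ := hex h2
    rw [← Nonneg.coe_add, h.term_pos, h.term_pos, h.term_pos, toNonneg_coe, h.add, map_mul,
      ← mul_assoc, mul_assoc (π a), ← h.mul_apply hL]
    simp only [mul_assoc]
  · obtain ⟨x, rfl⟩ := hex h1
    obtain ⟨y, rfl⟩ := hexn (not_le.mp h2).le
    obtain ⟨z, hz⟩ := hex h3
    obtain rfl : x = z + y := by
      ext; rw [Nonneg.coe_add, ← hz]; abel
    rw [hz, h.term_pos, h.term_pos, h.term_neg, toNonneg_coe, h.add, map_mul, mul_assoc,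
      ← h.mul_apply hL]
    rw [neg_neg, toNonneg_coe] at hb
    calc π a * (U z * π b) = π a * (U z * π (α y 1 * b)) := by rw [hb.1]
      _ = _ := by rw [map_mul, ← h.mul_star]; simp only [mul_assoc]
  · obtain ⟨x, rfl⟩ := hex h1
    obtain ⟨y, rfl⟩ := hexn (not_le.mp h2).le
    obtain ⟨z, hz⟩ := hexn (not_le.mp h3).le
    obtain rfl : y = z + x := by
      ext; rw [Nonneg.coe_add]
      have : (y : Γ) = x - (x + -y) := by abel
      rw [this, hz]; abel
    rw [hz, h.term_neg, h.term_pos, h.term_neg, neg_neg, toNonneg_coe, h.add, map_mul, star_mul,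
      ← mul_assoc, h.star_mul_apply hL]
    rw [toNonneg_coe] at ha
    calc π a * star (U z) * π b = π (a * α x 1) * star (U z) * π b := by rw [ha.2]
      _ = π a * π (α x 1) * star (U z) * π b := by rw [map_mul]
      _ = _ := by
        rw [← h.mul_star]
        simp only [mul_assoc]
  · obtain ⟨x, rfl⟩ := hexn (not_le.mp h1).le
    obtain ⟨y, rfl⟩ := hexn h4
    have : -(x : Γ) + -y = -((x + y : PosCone Γ) : Γ) := by rw [Nonneg.coe_add]; abel
    rw [this, h.term_neg, h.term_neg, h.term_neg, neg_neg, toNonneg_coe, add_comm x y, h.add,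
      star_mul, map_mul]
    simp only [mul_assoc]
    rw [← mul_assoc (star (U y)) (π (α y a)), h.star_mul_apply hL]
    simp only [mul_assoc]
  · obtain ⟨x, rfl⟩ := hexn (not_le.mp h1).le
    obtain ⟨y, rfl⟩ := hex (not_le.mp h4).le
    obtain ⟨z, hz⟩ := hex h5
    obtain rfl : y = x + z := by
      ext; rw [Nonneg.coe_add, ← hz]; abel
    rw [hz, h.term_neg, h.term_pos, h.term_pos, neg_neg, toNonneg_coe, h.add, ← h.star_conj,
      map_mul]
    simp only [mul_assoc]
  · obtain ⟨x, rfl⟩ := hexn (not_le.mp h1).le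
    obtain ⟨y, rfl⟩ := hex (not_le.mp h4).le
    obtain ⟨z, hz⟩ := hexn (not_le.mp h5).le
    obtain rfl : x = y + z := by
      ext; rw [Nonneg.coe_add]
      have : (x : Γ) = y - (-x + y) := by abel
      rw [this, hz]; abel
    rw [hz, h.term_neg, h.term_pos, h.term_neg, toNonneg_coe, h.add, ← h.star_conj,
      map_mul, star_mul]
    simp only [mul_assoc]

end IsCovariant

variable {α : EndAction Γ A} {L : PosCone Γ → (A →L[ℂ] A)}

theorem mulCoeff_mem (hL : IsCompleteTransferAction α L) (g k : Γ)
    {a b : A} (ha : a ∈ coeffSpace α g) (hb : b ∈ coeffSpace α k) :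
    mulCoeff α L g k a b ∈ coeffSpace α (g + k) := by
  rw [mem_coeffSpace_iff] at *
  have hex : ∀ {g : Γ}, 0 ≤ g → ∃ x : PosCone Γ, g = x := fun {g} hg => ⟨⟨g, hg⟩, rfl⟩
  have hexn : ∀ {g : Γ}, g ≤ 0 → ∃ x : PosCone Γ, g = -(x : Γ) :=
    fun {g} hg => ⟨⟨-g, neg_nonneg.mpr hg⟩, (neg_neg g).symm⟩
  have hn : ∀ x : PosCone Γ, toNonneg (-(x : Γ)) = 0 :=
    fun x => toNonneg_eq_zero (neg_nonpos.mpr x.2)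
  unfold mulCoeff
  split_ifs with h1 h2 h3 h4 h5
  · obtain ⟨x, rfl⟩ := hex h1
    obtain ⟨y, rfl⟩ := hex h2
    rw [← Nonneg.coe_add, toNonneg_coe, toNonneg_coe, hn, α.zero_apply, one_mul, mul_assoc,
      α.add_apply, ← map_mul]
    rw [toNonneg_coe] at hb
    exact ⟨rfl, by rw [hb.2]⟩
  · obtain ⟨x, rfl⟩ := hex h1
    obtain ⟨z, hz⟩ := hex h3
    rw [hz, hn, toNonneg_coe, α.zero_apply, one_mul, mul_assoc, α.apply_mul_one]
    exact ⟨rfl, rfl⟩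
  · obtain ⟨z, hz⟩ := hexn (not_le.mp h3).le
    rw [hz, neg_neg, toNonneg_coe, hn, α.zero_apply, mul_one, ← mul_assoc, α.one_mul_apply]
    exact ⟨rfl, rfl⟩
  · obtain ⟨x, rfl⟩ := hexn (not_le.mp h1).le
    obtain ⟨y, rfl⟩ := hexn h4
    have : -(x : Γ) + -y = -((y + x : PosCone Γ) : Γ) := by rw [Nonneg.coe_add]; abel
    rw [this, neg_neg, neg_neg, toNonneg_coe, toNonneg_coe, hn, α.zero_apply, mul_one,
      α.add_apply, ← mul_assoc, ← map_mul]
    rw [neg_neg, toNonneg_coe] at ha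
    exact ⟨by rw [ha.1], rfl⟩
  · obtain ⟨x, rfl⟩ := hexn (not_le.mp h1).le
    obtain ⟨y, rfl⟩ := hex (not_le.mp h4).le
    obtain ⟨z, hz⟩ := hex h5
    obtain rfl : y = x + z := by
      ext; rw [Nonneg.coe_add, ← hz]; abel
    rw [toNonneg_coe, α.add_apply] at hb
    rw [hz, hn, α.zero_apply, one_mul, neg_neg, toNonneg_coe, toNonneg_coe, ← hL.transfer',
      mul_assoc, hb.2]
    exact ⟨rfl, rfl⟩
  · obtain ⟨x, rfl⟩ := hexn (not_le.mp h1).le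
    obtain ⟨y, rfl⟩ := hex (not_le.mp h4).le
    obtain ⟨z, hz⟩ := hexn (not_le.mp h5).le
    obtain rfl : x = y + z := by
      ext; rw [Nonneg.coe_add]
      have : (x : Γ) = y - (-x + y) := by abel
      rw [this, hz]; abel
    rw [neg_neg, toNonneg_coe, α.add_apply] at ha
    rw [hz, hn, α.zero_apply, mul_one, neg_neg, toNonneg_coe, toNonneg_coe, ← hL.transfer,
      ← mul_assoc, ha.1]
    exact ⟨rfl, rfl⟩

theorem star_mem_coeffSpace {g : Γ} {a : A} (ha : a ∈ coeffSpace α g) :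
    star a ∈ coeffSpace α (-g) := by
  rw [mem_coeffSpace_iff] at *
  have h1 := congrArg star ha.1
  have h2 := congrArg star ha.2
  rw [star_mul, ← map_star, star_one] at h1 h2
  rw [neg_neg]
  exact ⟨h2, h1⟩

theorem IsCompleteTransferAction.norm_le (hL : IsCompleteTransferAction α L)
    (hα : IsFinelyRepresentable α) (x : PosCone Γ) (a : A) : ‖L x a‖ ≤ ‖a‖ := by
  obtain ⟨H, _, _, _, π, U, h⟩ := hα
  have hc := h.isCovariant hL
  have hU : ‖U x‖ ≤ 1 := by
    have h1 : ‖U x‖ * ‖U x‖ = ‖π (α x 1)‖ := by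
      rw [← hc.mul_star, CStarRing.norm_self_mul_star]
    have h2 : ‖α x 1‖ ≤ 1 := by
      have : ‖α x 1‖ * ‖α x 1‖ = ‖α x 1‖ := by
        rw [← CStarRing.norm_star_mul_self, ← map_star, star_one, α.apply_mul_one]
      nlinarith [norm_nonneg (α x 1)]
    rw [NonUnitalStarAlgHom.norm_map π h.faithful] at h1
    nlinarith [norm_nonneg (U x)]
  have hU' : ‖star (U x)‖ ≤ 1 := by rwa [norm_star]
  rw [← NonUnitalStarAlgHom.norm_map π h.faithful, ← hc.star_conj,
    ← NonUnitalStarAlgHom.norm_map π h.faithful a]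
  calc ‖star (U x) * π a * U x‖ ≤ ‖star (U x)‖ * ‖π a‖ * ‖U x‖ := norm_mul₃_le
    _ ≤ 1 * ‖π a‖ * 1 := by gcongr
    _ = ‖π a‖ := by ring

theorem norm_mulCoeff_le (hL : IsCompleteTransferAction α L) (hα : IsFinelyRepresentable α)
    (g k : Γ) (a b : A) : ‖mulCoeff α L g k a b‖ ≤ ‖a‖ * ‖b‖ := by
  unfold mulCoeff
  split_ifs
  iterate 2
    · refine (norm_mul_le _ _).trans ?_
      gcongr
      exact α.norm_le _ _
  iterate 2
    · refine (norm_mul_le _ _).trans ?_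
      gcongr
      exact α.norm_le _ _
  iterate 2
    · exact (hL.norm_le hα _ _).trans (norm_mul_le _ _)

theorem mulCoeff_add_left (g k : Γ) (a a' b : A) : mulCoeff α L g k (a + a') b =
    mulCoeff α L g k a b + mulCoeff α L g k a' b := by
  unfold mulCoeff
  split_ifs <;> simp only [map_add, add_mul]

theorem mulCoeff_add_right (g k : Γ) (a b b' : A) : mulCoeff α L g k a (b + b') =
    mulCoeff α L g k a b + mulCoeff α L g k a b' := by
  unfold mulCoeff
  split_ifs <;> simp only [map_add, mul_add]

theorem mulCoeff_smul_left (g k : Γ) (c : ℂ) (a b : A) : mulCoeff α L g k (c • a) b =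
    c • mulCoeff α L g k a b := by
  unfold mulCoeff
  split_ifs <;> simp only [map_smul, smul_mul_assoc]

theorem mulCoeff_smul_right (g k : Γ) (c : ℂ) (a b : A) : mulCoeff α L g k a (c • b) =
    c • mulCoeff α L g k a b := by
  unfold mulCoeff
  split_ifs <;> simp only [map_smul, mul_smul_comm]

theorem one_mulCoeff (k : Γ) {b : A} (hb : b ∈ coeffSpace α k) : mulCoeff α L 0 k 1 b = b := by
  rw [mem_coeffSpace_iff] at hb
  unfold mulCoeff
  rw [if_pos le_rfl, zero_add]
  split_ifs
  · rw [one_mul, toNonneg_eq_zero le_rfl, α.zero_apply]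
  · exact hb.1

theorem mulCoeff_one (k : Γ) {a : A} (ha : a ∈ coeffSpace α k) : mulCoeff α L k 0 a 1 = a := by
  rw [mem_coeffSpace_iff] at ha
  unfold mulCoeff
  rw [if_pos le_rfl, if_pos le_rfl]
  split_ifs
  · exact ha.2
  · rw [mul_one, neg_zero, toNonneg_eq_zero le_rfl, α.zero_apply]

theorem mulCoeff_assoc (hL : IsCompleteTransferAction α L) (hα : IsFinelyRepresentable α)
    (g k l : Γ) {a b c : A} (ha : a ∈ coeffSpace α g) (hb : b ∈ coeffSpace α k)
    (hc : c ∈ coeffSpace α l) :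
    mulCoeff α L (g + k) l (mulCoeff α L g k a b) c =
      mulCoeff α L g (k + l) a (mulCoeff α L k l b c) := by
  obtain ⟨H, _, _, _, π, U, h⟩ := hα
  have hcov := h.isCovariant hL
  have h1 := mulCoeff_mem hL g k ha hb
  have h2 := mulCoeff_mem hL k l hb hc
  refine hcov.eq_of_term_eq h.faithful (g + k + l) (mulCoeff_mem hL _ _ h1 hc) ?_ ?_
  · rw [add_assoc]; exact mulCoeff_mem hL _ _ ha h2
  · rw [hcov.term_mul hL _ _ h1 hc, hcov.term_mul hL _ _ ha hb, add_assoc,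
      hcov.term_mul hL _ _ ha h2, hcov.term_mul hL _ _ hb hc, mul_assoc]

theorem star_mulCoeff (hL : IsCompleteTransferAction α L) (hα : IsFinelyRepresentable α)
    (g k : Γ) {a b : A} (ha : a ∈ coeffSpace α g) (hb : b ∈ coeffSpace α k) :
    star (mulCoeff α L g k a b) = mulCoeff α L (-k) (-g) (star b) (star a) := by
  obtain ⟨H, _, _, _, π, U, h⟩ := hα
  have hcov := h.isCovariant hL
  have ha' := star_mem_coeffSpace ha
  have hb' := star_mem_coeffSpace hb
  refine hcov.eq_of_term_eq h.faithful (-(g + k))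
    (star_mem_coeffSpace (mulCoeff_mem hL g k ha hb)) ?_ ?_
  · rw [neg_add_rev]; exact mulCoeff_mem hL _ _ hb' ha'
  · rw [hcov.term_star, hcov.term_mul hL _ _ ha hb, neg_add_rev, hcov.term_mul hL _ _ hb' ha',
      hcov.term_star, hcov.term_star, star_mul]

end Coeff


section L1

universe w u v

variable {Γ : Type u} {A : Type v} [AddCommGroup Γ] [LinearOrder Γ] [IsOrderedAddMonoid Γ]
  [CStarAlgebra A] {α : EndAction Γ A}

/-- The space `l₁(Γ, α, A)` of absolutely summable families `(a_g)` with `a_g` in the coefficient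
space of degree `g`, normed by `∑ ‖a_g‖`. -/
def L1 (_hα : IsFinelyRepresentable.{w} α) : Type (max u v) :=
  lp (fun g : Γ => coeffSpace α g) 1

namespace L1

variable {hα : IsFinelyRepresentable.{w} α}

noncomputable instance : NormedAddCommGroup (L1 hα) :=
  inferInstanceAs (NormedAddCommGroup (lp (fun g : Γ => coeffSpace α g) 1))

noncomputable instance : NormedSpace ℂ (L1 hα) :=
  inferInstanceAs (NormedSpace ℂ (lp (fun g : Γ => coeffSpace α g) 1))

instance (g : Γ) : CompleteSpace (coeffSpace α g) := by
  have : IsClosed (coeffSpace α g : Set A) := by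
    have h : (coeffSpace α g : Set A) = {a | α (Nonneg.toNonneg (-g)) 1 * a = a} ∩
        {a | a * α (Nonneg.toNonneg g) 1 = a} := by
      ext a; exact mem_coeffSpace_iff α g a
    rw [h]
    exact (isClosed_eq (continuous_const_mul _) continuous_id).inter
      (isClosed_eq (continuous_mul_const _) continuous_id)
  exact this.completeSpace_coe

instance : CompleteSpace (L1 hα) :=
  inferInstanceAs (CompleteSpace (lp (fun g : Γ => coeffSpace α g) 1))

/-- The `g`-th coefficient `a_g`. -/
def coeff (a : L1 hα) (g : Γ) : A :=
  ((show lp (fun g : Γ => coeffSpace α g) 1 from a) : (g : Γ) → coeffSpace α g) g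

theorem coeff_mem (a : L1 hα) (g : Γ) : a.coeff g ∈ coeffSpace α g := Subtype.property _

theorem hasSum_norm (a : L1 hα) : HasSum (fun g => ‖a.coeff g‖) ‖a‖ := by
  have := lp.hasSum_norm (p := 1) (by simp) (show lp (fun g : Γ => coeffSpace α g) 1 from a)
  simp only [ENNReal.toReal_one, Real.rpow_one] at this
  exact this

theorem summable_norm (a : L1 hα) : Summable (fun g => ‖a.coeff g‖) := a.hasSum_norm.summable

@[ext] theorem ext {a b : L1 hα} (h : ∀ g, a.coeff g = b.coeff g) : a = b :=
  lp.ext (funext fun g => Subtype.ext (h g))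

/-- The family `f` as an element of `l₁(Γ, α, A)`. -/
def mk (f : Γ → A) (hf : ∀ g, f g ∈ coeffSpace α g) (hs : Summable fun g => ‖f g‖) : L1 hα :=
  (⟨fun g => ⟨f g, hf g⟩, memℓp_gen (by simpa using hs)⟩ : lp (fun g : Γ => coeffSpace α g) 1)

@[simp] theorem coeff_mk (f : Γ → A) (hf : ∀ g, f g ∈ coeffSpace α g)
    (hs : Summable fun g => ‖f g‖) (g : Γ) : (mk f hf hs : L1 hα).coeff g = f g := rfl

@[simp] theorem coeff_add (a b : L1 hα) (g : Γ) : (a + b).coeff g = a.coeff g + b.coeff g := rfl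

@[simp] theorem coeff_zero (g : Γ) : (0 : L1 hα).coeff g = 0 := rfl

@[simp] theorem coeff_smul (c : ℂ) (a : L1 hα) (g : Γ) : (c • a).coeff g = c • a.coeff g := rfl

theorem norm_coeff_le (a : L1 hα) (g : Γ) : ‖a.coeff g‖ ≤ ‖a‖ :=
  le_hasSum a.hasSum_norm g (fun _ _ => norm_nonneg _)

theorem summable_aux (a b : L1 hα) :
    HasSum (fun p : Γ × Γ => ‖a.coeff p.2‖ * ‖b.coeff (p.1 - p.2)‖) (‖a‖ * ‖b‖) := by
  let e : Γ × Γ ≃ Γ × Γ :=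
    { toFun := fun p => (p.2, p.1 - p.2)
      invFun := fun q => (q.1 + q.2, q.1)
      left_inv := fun p => by simp
      right_inv := fun q => by simp }
  have h1 : HasSum (fun q : Γ × Γ => ‖a.coeff q.1‖ * ‖b.coeff q.2‖) (‖a‖ * ‖b‖) :=
    a.hasSum_norm.mul b.hasSum_norm
      (a.summable_norm.mul_of_nonneg b.summable_norm (fun _ => norm_nonneg _)
        (fun _ => norm_nonneg _))
  exact (e.hasSum_iff (f := fun q : Γ × Γ => ‖a.coeff q.1‖ * ‖b.coeff q.2‖)).mpr h1

theorem summable_mulCoeff_norm (a b : L1 hα) (g : Γ) :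
    Summable (fun h => ‖mulCoeff α hα.transfer h (g - h) (a.coeff h) (b.coeff (g - h))‖) :=
  Summable.of_nonneg_of_le (fun _ => norm_nonneg _)
    (fun _ => norm_mulCoeff_le hα.isComplete_transfer hα _ _ _ _)
    ((summable_aux a b).summable.prod_factor g)

theorem norm_tsum_mulCoeff_le (a b : L1 hα) (g : Γ) :
    ‖∑' h, mulCoeff α hα.transfer h (g - h) (a.coeff h) (b.coeff (g - h))‖ ≤
      ∑' h, ‖a.coeff h‖ * ‖b.coeff (g - h)‖ :=
  (norm_tsum_le_tsum_norm (summable_mulCoeff_norm a b g)).trans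
    ((summable_mulCoeff_norm a b g).tsum_le_tsum
      (fun _ => norm_mulCoeff_le hα.isComplete_transfer hα _ _ _ _)
      ((summable_aux a b).summable.prod_factor g))

theorem tsum_mem_coeffSpace {ι : Type*} {g : Γ} {f : ι → A} (hf : ∀ i, f i ∈ coeffSpace α g)
    (hs : Summable f) : ∑' i, f i ∈ coeffSpace α g := by
  simp only [mem_coeffSpace_iff] at *
  rw [← hs.tsum_mul_left, ← hs.tsum_mul_right]
  exact ⟨tsum_congr fun i => (hf i).1, tsum_congr fun i => (hf i).2⟩

/-- The product `(a · b)_g = ∑_{h + k = g} (a_h δ_h · b_k δ_k)_g`, an absolutely convergent sum. -/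
noncomputable instance : Mul (L1 hα) where
  mul a b := mk
    (fun g => ∑' h, mulCoeff α hα.transfer h (g - h) (a.coeff h) (b.coeff (g - h)))
    (fun g => tsum_mem_coeffSpace (fun h => by
        have := mulCoeff_mem hα.isComplete_transfer h (g - h) (a.coeff_mem h)
          (b.coeff_mem (g - h))
        rwa [add_sub_cancel] at this) (summable_mulCoeff_norm a b g).of_norm)
    (Summable.of_nonneg_of_le (fun _ => norm_nonneg _) (norm_tsum_mulCoeff_le a b)
      (summable_aux a b).summable.prod)

theorem coeff_mul (a b : L1 hα) (g : Γ) : (a * b).coeff g =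
    ∑' h, mulCoeff α hα.transfer h (g - h) (a.coeff h) (b.coeff (g - h)) := rfl

theorem norm_mul_le' (a b : L1 hα) : ‖a * b‖ ≤ ‖a‖ * ‖b‖ := by
  have h1 := (summable_aux a b).summable
  calc ‖a * b‖ = ∑' g, ‖(a * b).coeff g‖ := (hasSum_norm _).tsum_eq.symm
    _ ≤ ∑' g, ∑' h, ‖a.coeff h‖ * ‖b.coeff (g - h)‖ :=
      (summable_norm _).tsum_le_tsum (norm_tsum_mulCoeff_le a b) h1.prod
    _ = ‖a‖ * ‖b‖ := by rw [← (summable_aux a b).tsum_eq, h1.tsum_prod]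

/-- The involution `(a^*)_g = (a_{-g})^*`. -/
noncomputable instance : Star (L1 hα) where
  star a := mk (fun g => star (a.coeff (-g)))
    (fun g => by simpa using star_mem_coeffSpace (a.coeff_mem (-g)))
    (by
      simp only [norm_star]
      exact ((Equiv.neg Γ).summable_iff (f := fun g => ‖a.coeff g‖)).mpr a.summable_norm)

theorem coeff_star (a : L1 hα) (g : Γ) : (star a).coeff g = star (a.coeff (-g)) := rfl

/-- The element `a δ_g`. -/
noncomputable def single (g : Γ) (a : A) (ha : a ∈ coeffSpace α g) : L1 hα :=
  (lp.single 1 g ⟨a, ha⟩ : lp (fun g : Γ => coeffSpace α g) 1)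

theorem coeff_single_self (g : Γ) (a : A) (ha : a ∈ coeffSpace α g) :
    (single g a ha : L1 hα).coeff g = a :=
  congrArg Subtype.val (lp.single_apply_self (E := fun g : Γ => coeffSpace α g) 1 g ⟨a, ha⟩)

theorem coeff_single_ne (g : Γ) (a : A) (ha : a ∈ coeffSpace α g) {k : Γ} (hk : k ≠ g) :
    (single g a ha : L1 hα).coeff k = 0 :=
  congrArg Subtype.val (lp.single_apply_ne (E := fun g : Γ => coeffSpace α g) 1 g ⟨a, ha⟩ hk)

theorem one_mem_coeffSpace : (1 : A) ∈ coeffSpace α 0 := by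
  rw [mem_coeffSpace_iff]
  rw [neg_zero, toNonneg_eq_zero le_rfl, α.zero_apply, one_mul]
  exact ⟨rfl, rfl⟩

noncomputable instance : One (L1 hα) := ⟨single 0 1 one_mem_coeffSpace⟩

theorem one_def : (1 : L1 hα) = single 0 1 one_mem_coeffSpace := rfl

theorem induct {P : L1 hα → Prop} (hc : IsClosed {a | P a}) (h0 : P 0)
    (hadd : ∀ a b, P a → P b → P (a + b)) (hs : ∀ g a ha, P (single g a ha)) (a : L1 hα) :
    P a := by
  have h1 := lp.hasSum_single (p := 1) (by simp)
    (show lp (fun g : Γ => coeffSpace α g) 1 from a)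
  refine hc.mem_of_tendsto h1 (Filter.Eventually.of_forall fun s => ?_)
  induction s using Finset.cons_induction with
  | empty => exact h0
  | cons i s hi ih =>
    rw [Finset.sum_cons]
    exact hadd _ _ (hs i _ _) ih

theorem single_mul_single (g k : Γ) {a b : A} (ha : a ∈ coeffSpace α g)
    (hb : b ∈ coeffSpace α k) : (single g a ha * single k b hb : L1 hα) =
      single (g + k) (mulCoeff α hα.transfer g k a b)
        (mulCoeff_mem hα.isComplete_transfer g k ha hb) := by
  have z1 : ∀ h l b, mulCoeff α hα.transfer h l 0 b = 0 := fun h l b => by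
    simpa using mulCoeff_smul_left (α := α) (L := hα.transfer) h l 0 0 b
  have z2 : ∀ h l a, mulCoeff α hα.transfer h l a 0 = 0 := fun h l a => by
    simpa using mulCoeff_smul_right (α := α) (L := hα.transfer) h l 0 a 0
  ext m
  rw [coeff_mul, tsum_eq_single g, coeff_single_self]
  · by_cases hm : m = g + k
    · subst hm
      rw [add_sub_cancel_left, coeff_single_self, coeff_single_self]
    · rw [coeff_single_ne _ _ _ hm, coeff_single_ne _ _ _ (by rwa [Ne, sub_eq_iff_eq_add']), z2]
  · intro h hh
    rw [coeff_single_ne _ _ _ hh, z1]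

theorem star_single (g : Γ) {a : A} (ha : a ∈ coeffSpace α g) :
    star (single g a ha : L1 hα) = single (-g) (star a) (star_mem_coeffSpace ha) := by
  ext m
  rw [coeff_star]
  by_cases hm : m = -g
  · subst hm
    rw [coeff_single_self, neg_neg, coeff_single_self]
  · rw [coeff_single_ne _ _ _ hm, coeff_single_ne _ _ _ (by rwa [Ne, neg_eq_iff_eq_neg]),
      star_zero]

theorem single_congr {g k : Γ} (h : g = k) {a b : A} (hab : a = b) (ha : a ∈ coeffSpace α g)
    (hb : b ∈ coeffSpace α k) : (single g a ha : L1 hα) = single k b hb := by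
  subst h hab; rfl

protected theorem add_mul (a b c : L1 hα) : (a + b) * c = a * c + b * c := by
  ext g
  simp only [coeff_mul, coeff_add, mulCoeff_add_left]
  exact (summable_mulCoeff_norm a c g).of_norm.tsum_add (summable_mulCoeff_norm b c g).of_norm

protected theorem mul_add (a b c : L1 hα) : a * (b + c) = a * b + a * c := by
  ext g
  simp only [coeff_mul, coeff_add, mulCoeff_add_right]
  exact (summable_mulCoeff_norm a b g).of_norm.tsum_add (summable_mulCoeff_norm a c g).of_norm

protected theorem smul_mul (c : ℂ) (a b : L1 hα) : (c • a) * b = c • (a * b) := by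
  ext g
  simp only [coeff_mul, coeff_smul, mulCoeff_smul_left]
  exact (summable_mulCoeff_norm a b g).of_norm.tsum_const_smul c

protected theorem mul_smul (c : ℂ) (a b : L1 hα) : a * (c • b) = c • (a * b) := by
  ext g
  simp only [coeff_mul, coeff_smul, mulCoeff_smul_right]
  exact (summable_mulCoeff_norm a b g).of_norm.tsum_const_smul c

/-- The multiplication as a continuous bilinear map. -/
noncomputable def mulL (hα : IsFinelyRepresentable.{w} α) : L1 hα →L[ℂ] L1 hα →L[ℂ] L1 hα :=
  LinearMap.mkContinuous₂ (LinearMap.mk₂ ℂ (fun a b : L1 hα => a * b) L1.add_mul L1.smul_mul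
    L1.mul_add L1.mul_smul) 1 (fun a b => by
      rw [one_mul]; exact norm_mul_le' a b)

theorem continuous_mul_aux : Continuous (fun p : L1 hα × L1 hα => p.1 * p.2) :=
  (mulL hα).continuous₂

protected theorem zero_mul (a : L1 hα) : 0 * a = 0 := by
  simpa using L1.smul_mul 0 0 a

protected theorem mul_zero (a : L1 hα) : a * 0 = 0 := by
  simpa using L1.mul_smul 0 a 0

protected theorem mul_assoc (a b c : L1 hα) : a * b * c = a * (b * c) := by
  have hm := continuous_mul_aux (hα := hα)
  have cl : ∀ x : L1 hα, Continuous (fun a => a * x) := fun x =>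
    hm.comp (continuous_id.prodMk continuous_const)
  have cr : ∀ x : L1 hα, Continuous (fun a => x * a) := fun x =>
    hm.comp (continuous_const.prodMk continuous_id)
  refine induct (P := fun a => a * b * c = a * (b * c))
    (isClosed_eq ((cl c).comp (cl b)) (cl _)) (by simp only [L1.zero_mul])
    (fun a a' h h' => by simp only [L1.add_mul, h, h']) (fun g a ha => ?_) a
  refine induct (P := fun b => single g a ha * b * c = single g a ha * (b * c))
    (isClosed_eq ((cl c).comp (cr _)) ((cr _).comp (cl _)))
    (by simp only [L1.zero_mul, L1.mul_zero])
    (fun a a' h h' => by simp only [L1.add_mul, L1.mul_add, h, h']) (fun k b hb => ?_) b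
  refine induct (P := fun c => single g a ha * single k b hb * c =
      single g a ha * (single k b hb * c))
    (isClosed_eq (cr _) ((cr _).comp (cr _)))
    (by simp only [L1.mul_zero])
    (fun a a' h h' => by simp only [L1.mul_add, h, h']) (fun l c hc => ?_) c
  rw [single_mul_single, single_mul_single, single_mul_single, single_mul_single]
  exact single_congr (add_assoc _ _ _)
    (mulCoeff_assoc hα.isComplete_transfer hα _ _ _ ha hb hc) _ _

protected theorem one_mul (a : L1 hα) : 1 * a = a := by
  refine induct (P := fun a => 1 * a = a)
    (isClosed_eq (continuous_mul_aux.comp (continuous_const.prodMk continuous_id))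
      continuous_id) (L1.mul_zero _) (fun a b h h' => by simp only [L1.mul_add, h, h'])
    (fun g a ha => ?_) a
  rw [one_def, single_mul_single]
  exact single_congr (zero_add _) (one_mulCoeff _ ha) _ _

protected theorem mul_one (a : L1 hα) : a * 1 = a := by
  refine induct (P := fun a => a * 1 = a)
    (isClosed_eq (continuous_mul_aux.comp (continuous_id.prodMk continuous_const))
      continuous_id) (L1.zero_mul _) (fun a b h h' => by simp only [L1.add_mul, h, h'])
    (fun g a ha => ?_) a
  rw [one_def, single_mul_single]
  exact single_congr (add_zero _) (mulCoeff_one _ ha) _ _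

noncomputable instance : NormedRing (L1 hα) where
  __ := (inferInstance : NormedAddCommGroup (L1 hα))
  left_distrib := L1.mul_add
  right_distrib := L1.add_mul
  zero_mul := L1.zero_mul
  mul_zero := L1.mul_zero
  mul_assoc := L1.mul_assoc
  one_mul := L1.one_mul
  mul_one := L1.mul_one
  norm_mul_le := norm_mul_le'

noncomputable instance : NormedAlgebra ℂ (L1 hα) where
  __ := Algebra.ofModule (R := ℂ) (A := L1 hα) L1.smul_mul (fun c a b => L1.mul_smul c a b)
  norm_smul_le := norm_smul_le

theorem norm_star_aux (a : L1 hα) : ‖star a‖ = ‖a‖ := by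
  rw [← (hasSum_norm (star a)).tsum_eq, ← a.hasSum_norm.tsum_eq]
  simp only [coeff_star, norm_star]
  exact (Equiv.neg Γ).tsum_eq (fun g => ‖a.coeff g‖)

theorem star_add_aux (a b : L1 hα) : star (a + b) = star a + star b := by
  ext g
  simp only [coeff_star, coeff_add, star_add]

theorem continuous_star_aux : Continuous (star : L1 hα → L1 hα) := by
  let f : L1 hα →+ L1 hα :=
    { toFun := star
      map_zero' := by ext g; simp [coeff_star]
      map_add' := star_add_aux }
  exact AddMonoidHomClass.continuous_of_bound f 1 (fun a => by
    rw [one_mul]; exact (norm_star_aux a).le)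

theorem star_mul_aux (a b : L1 hα) : star (a * b) = star b * star a := by
  have hs := continuous_star_aux (hα := hα)
  have h0 : star (0 : L1 hα) = 0 := by ext g; simp [coeff_star]
  refine induct (P := fun a => star (a * b) = star b * star a)
    (isClosed_eq (hs.comp (continuous_mul_const b)) (hs.const_mul _)) (by simp [h0])
    (fun a a' h h' => by simp only [add_mul, mul_add, star_add_aux, h, h']) (fun g a ha => ?_) a
  refine induct (P := fun b => star (single g a ha * b) = star b * star (single g a ha))
    (isClosed_eq (hs.comp (continuous_const_mul _)) (hs.mul_const _)) (by simp [h0])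
    (fun a a' h h' => by simp only [add_mul, mul_add, star_add_aux, h, h']) (fun k b hb => ?_) b
  rw [single_mul_single, star_single, star_single, star_single, single_mul_single]
  exact single_congr (neg_add_rev _ _) (star_mulCoeff hα.isComplete_transfer hα _ _ ha hb) _ _

noncomputable instance : StarRing (L1 hα) where
  star_involutive a := by ext g; simp [coeff_star]
  star_mul := star_mul_aux
  star_add := star_add_aux

instance : StarModule ℂ (L1 hα) where
  star_smul c a := by ext g; simp [coeff_star]

instance : NormedStarGroup (L1 hα) where
  norm_star_le a := (norm_star_aux a).le

end L1

end L1


end Main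

section Enveloping

/-- A contractive C⋆-seminorm on a normed ⋆-algebra. On a Banach ⋆-algebra with isometric
involution these are exactly the seminorms `b ↦ ‖ρ b‖` for ⋆-representations `ρ` on Hilbert spaces,
as such representations are automatically contractive. -/
structure IsCStarSeminorm {B : Type*} [NormedRing B] [StarRing B] [NormedAlgebra ℂ B]
    (p : Seminorm ℂ B) : Prop where
  mul_le : ∀ a b, p (a * b) ≤ p a * p b
  star_mul_self : ∀ a, p (star a * a) = p a ^ 2
  le_norm : ∀ a, p a ≤ ‖a‖

namespace EnvelopingCStar

variable (B : Type*) [NormedRing B] [StarRing B] [NormedAlgebra ℂ B]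

instance : Nonempty {p : Seminorm ℂ B // IsCStarSeminorm p} :=
  ⟨⟨0, ⟨fun a b => by simp, fun a => by simp, fun a => by simp⟩⟩⟩

theorem bddAbove (a : B) :
    BddAbove (Set.range fun p : {p : Seminorm ℂ B // IsCStarSeminorm p} => p.1 a) :=
  ⟨‖a‖, by rintro _ ⟨p, rfl⟩; exact p.2.le_norm a⟩

variable {B} in
/-- The value at `a` of the largest C⋆-seminorm. -/
noncomputable def maxNorm (a : B) : ℝ := ⨆ p : {p : Seminorm ℂ B // IsCStarSeminorm p}, p.1 a

theorem le_maxNorm (p : {p : Seminorm ℂ B // IsCStarSeminorm p}) (a : B) : p.1 a ≤ maxNorm a :=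
  le_ciSup (bddAbove B a) p

theorem maxNorm_nonneg (a : B) : 0 ≤ maxNorm a :=
  Real.iSup_nonneg fun p => apply_nonneg p.1 a

theorem maxNorm_le_norm (a : B) : maxNorm a ≤ ‖a‖ := ciSup_le fun p => p.2.le_norm a

theorem maxNorm_mul_le (a b : B) : maxNorm (a * b) ≤ maxNorm a * maxNorm b :=
  ciSup_le fun p => (p.2.mul_le a b).trans
    (mul_le_mul (le_maxNorm B p a) (le_maxNorm B p b) (apply_nonneg _ _) (maxNorm_nonneg B a))

theorem maxNorm_star_mul_self (a : B) : maxNorm (star a * a) = maxNorm a ^ 2 := by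
  apply le_antisymm
  · refine ciSup_le fun p => ?_
    rw [p.2.star_mul_self]
    exact pow_le_pow_left₀ (apply_nonneg _ _) (le_maxNorm B p a) 2
  · rw [← Real.le_sqrt (maxNorm_nonneg B _) (maxNorm_nonneg B _)]
    refine ciSup_le fun p => Real.le_sqrt_of_sq_le ?_
    rw [← p.2.star_mul_self]
    exact le_maxNorm B p _

/-- `B` itself, to be endowed with the largest C⋆-seminorm. -/
def Pre : Type _ := B

noncomputable instance : Ring (Pre B) := inferInstanceAs (Ring B)
noncomputable instance : StarRing (Pre B) := inferInstanceAs (StarRing B)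
noncomputable instance : Algebra ℂ (Pre B) := inferInstanceAs (Algebra ℂ B)
instance [StarModule ℂ B] : StarModule ℂ (Pre B) := inferInstanceAs (StarModule ℂ B)

/-- The largest C⋆-seminorm as a ring seminorm. -/
noncomputable def ringSeminorm : RingSeminorm (Pre B) where
  toFun a := maxNorm (show B from a)
  map_zero' := le_antisymm ((maxNorm_le_norm B 0).trans norm_zero.le) (maxNorm_nonneg B 0)
  add_le' a b := ciSup_le fun p => (map_add_le_add p.1 _ _).trans
    (add_le_add (le_maxNorm B p a) (le_maxNorm B p b))
  neg' _ := iSup_congr fun p => map_neg_eq_map p.1 _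
  mul_le' a b := maxNorm_mul_le B a b

noncomputable instance : SeminormedRing (Pre B) := (ringSeminorm B).toSeminormedRing

theorem norm_def (a : Pre B) : ‖a‖ = maxNorm (show B from a) := rfl

noncomputable instance : NormedAlgebra ℂ (Pre B) where
  norm_smul_le c a := ciSup_le fun p => (map_smul_eq_mul p.1 c _).le.trans
    (mul_le_mul_of_nonneg_left (le_maxNorm B p a) (norm_nonneg c))

theorem norm_star_mul_self (a : Pre B) : ‖star a * a‖ = ‖a‖ ^ 2 := maxNorm_star_mul_self B a

theorem norm_star_le (a : Pre B) : ‖star a‖ ≤ ‖a‖ := by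
  have key : ∀ a : Pre B, ‖a‖ ≤ ‖star a‖ := fun a => by
    have h1 := norm_mul_le (star a) a
    rw [norm_star_mul_self] at h1
    by_contra! h
    nlinarith [norm_nonneg (star a)]
  simpa using key (star a)

instance : NormedStarGroup (Pre B) := ⟨norm_star_le B⟩

end EnvelopingCStar

/-- The enveloping C⋆-algebra of a normed ⋆-algebra `B`: the Hausdorff completion of `B` in the
largest C⋆-seminorm, that is, in the seminorm `b ↦ sup ‖ρ b‖` over all ⋆-representations `ρ`. -/
def EnvelopingCStar (B : Type*) [NormedRing B] [StarRing B] [NormedAlgebra ℂ B]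
    [StarModule ℂ B] : Type _ :=
  UniformSpace.Completion (EnvelopingCStar.Pre B)

namespace EnvelopingCStar

variable (B : Type*) [NormedRing B] [StarRing B] [NormedAlgebra ℂ B] [StarModule ℂ B]

open UniformSpace

noncomputable instance : NormedRing (EnvelopingCStar B) :=
  inferInstanceAs (NormedRing (Completion (Pre B)))

instance : CompleteSpace (EnvelopingCStar B) :=
  inferInstanceAs (CompleteSpace (Completion (Pre B)))

noncomputable instance : Algebra ℂ (EnvelopingCStar B) :=
  inferInstanceAs (Algebra ℂ (Completion (Pre B)))

noncomputable instance : NormedAlgebra ℂ (EnvelopingCStar B) where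
  norm_smul_le c a := by
    have := norm_smul_le c (show Completion (Pre B) from a)
    exact this

/-- The canonical map on underlying types. -/
noncomputable def of (b : B) : EnvelopingCStar B := ((show Pre B from b : Pre B) : Completion (Pre B))

theorem induct {P : EnvelopingCStar B → Prop} (hc : IsClosed {a | P a}) (h : ∀ b, P (of B b))
    (a : EnvelopingCStar B) : P a :=
  Completion.induction_on (α := Pre B) (p := P) a hc h

theorem norm_of (b : B) : ‖of B b‖ = maxNorm b := Completion.norm_coe (E := Pre B) b

theorem of_mul (a b : B) : of B (a * b) = of B a * of B b := Completion.coe_mul (α := Pre B) a b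
theorem of_add (a b : B) : of B (a + b) = of B a + of B b := Completion.coe_add (α := Pre B) a b
theorem of_zero : of B 0 = 0 := Completion.coe_zero (α := Pre B)
theorem of_smul (c : ℂ) (b : B) : of B (c • b) = c • of B b :=
  Completion.coe_smul (X := Pre B) c b

/-- The involution is the continuous extension of the involution of `B`. -/
noncomputable instance : Star (EnvelopingCStar B) :=
  ⟨Completion.map (star : Pre B → Pre B)⟩

theorem uniformContinuous_star_pre : UniformContinuous (star : Pre B → Pre B) :=
  (starₗᵢ ℂ : Pre B ≃ₗᵢ⋆[ℂ] Pre B).isometry.uniformContinuous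

theorem of_star (b : B) : of B (star b) = star (of B b) :=
  (Completion.map_coe (uniformContinuous_star_pre B) b).symm

theorem continuous_star_aux : Continuous (star : EnvelopingCStar B → EnvelopingCStar B) :=
  Completion.continuous_map (f := (star : Pre B → Pre B))

noncomputable instance : StarRing (EnvelopingCStar B) where
  star_involutive a := induct B (P := fun a => star (star a) = a)
    (isClosed_eq ((continuous_star_aux B).comp (continuous_star_aux B)) continuous_id)
    (fun b => by rw [← of_star, ← of_star, star_star]) a
  star_mul a b := by
    have hs := continuous_star_aux B
    refine induct B (P := fun a => star (a * b) = star b * star a)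
      (isClosed_eq (hs.comp (continuous_mul_const b)) (hs.const_mul _)) (fun a => ?_) a
    refine induct B (P := fun b => star (of B a * b) = star b * star (of B a))
      (isClosed_eq (hs.comp (continuous_const_mul _)) (hs.mul_const _)) (fun b => ?_) b
    rw [← of_mul, ← of_star, ← of_star, ← of_star, ← of_mul, star_mul]
  star_add a b := by
    have hs := continuous_star_aux B
    refine induct B (P := fun a => star (a + b) = star a + star b)
      (isClosed_eq (hs.comp (continuous_add_const b)) (hs.add continuous_const)) (fun a => ?_) a
    refine induct B (P := fun b => star (of B a + b) = star (of B a) + star b)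
      (isClosed_eq (hs.comp (continuous_const_add _)) (continuous_const.add hs)) (fun b => ?_) b
    rw [← of_add, ← of_star, ← of_star, ← of_star, ← of_add, star_add]

noncomputable instance : CStarAlgebra (EnvelopingCStar B) where
  norm_mul_self_le a := induct B (P := fun a => ‖a‖ * ‖a‖ ≤ ‖star a * a‖)
    (isClosed_le (continuous_norm.mul continuous_norm)
      (((continuous_star_aux B).mul continuous_id).norm))
    (fun b => by
      rw [← of_star, ← of_mul, norm_of, norm_of, maxNorm_star_mul_self, sq]) a
  star_smul c a := induct B (P := fun a => star (c • a) = star c • star a)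
    (isClosed_eq ((continuous_star_aux B).comp (continuous_const_smul c))
      ((continuous_star_aux B).const_smul (star c)))
    (fun b => by rw [← of_smul, ← of_star, ← of_star, star_smul, of_smul]) a

/-- The canonical ⋆-homomorphism from `B` to its enveloping C⋆-algebra. -/
noncomputable def ι : B →⋆ₙₐ[ℂ] EnvelopingCStar B where
  toFun := of B
  map_smul' := of_smul B
  map_zero' := of_zero B
  map_add' := of_add B
  map_mul' := of_mul B
  map_star' := of_star B

end EnvelopingCStar

end Enveloping

section CrossedProduct

universe w u v t

variable {Γ : Type u} {A : Type v} [AddCommGroup Γ] [LinearOrder Γ] [IsOrderedAddMonoid Γ]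
  [CStarAlgebra A] {α : EndAction Γ A}

/-- The crossed product `A ⋊_α Γ`. -/
abbrev CrossedProduct (hα : IsFinelyRepresentable.{w} α) : Type (max u v) :=
  EnvelopingCStar (L1 hα)

/-- The covariant representations `(π, U)` of `(A, Γ⁺, α)` on the Hilbert space `H`. -/
structure CovariantRep (hα : IsFinelyRepresentable.{w} α) (H : Type t) [NormedAddCommGroup H]
    [InnerProductSpace ℂ H] [CompleteSpace H] where
  π : A →⋆ₙₐ[ℂ] (H →L[ℂ] H)
  U : PosCone Γ → (H →L[ℂ] H)
  isCovariant : IsCovariant α hα.transfer π U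

/-- `ρ` is the representation `π × U` of the crossed product: on (the class of) `a ∈ l₁(Γ, α, A)` it
is given by the norm convergent sum `∑_{x>0} U_x^* π(a_{-x}) + π(a_0) + ∑_{x>0} π(a_x) U_x`. -/
def IsIntegratedForm {hα : IsFinelyRepresentable.{w} α} {H : Type t} [NormedAddCommGroup H]
    [InnerProductSpace ℂ H] [CompleteSpace H] (R : CovariantRep hα H)
    (ρ : CrossedProduct hα →⋆ₙₐ[ℂ] (H →L[ℂ] H)) : Prop :=
  ∀ a : L1 hα, HasSum (fun g => homogeneousTerm R.π R.U g (a.coeff g))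
    (ρ (EnvelopingCStar.ι (L1 hα) a))

end CrossedProduct

/-! Write `a δ_g` for the family with the single entry `a` in degree `g`. These elements span a
dense subspace of `l₁(Γ, α, A)`, so continuous identities only have to be checked on them.

From pairs to representations: with `g⁺ = max g 0`, a covariant pair sends `a δ_g` to `U_{(-g)⁺}^*
π(a) U_{g⁺}`. Covariance makes these operators multiply and conjugate as the elements `a δ_g` do
(`IsCovariant.term_mul`, `IsCovariant.term_star`), and since each `U_x` is a contraction their norm
is at most `‖a‖` (`IsCovariant.norm_term_le`). The sum over `g` therefore converges absolutely to a
contractive ⋆-representation of `l₁(Γ, α, A)`, which extends uniquely to the enveloping algebra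
(`EnvelopingCStar.exists_lift`, `EnvelopingCStar.hom_ext`).

From representations to pairs: inside `l₁(Γ, α, A)` the elements `a δ_0` and `s_x = α_x(1) δ_x`
already satisfy the covariance relations, and every `a δ_g` is either `(a δ_0) s_x` or `s_x^* (a
δ_0)`. Hence a non-degenerate `ρ` restricts to a covariant pair and is the integrated form of that
pair (`CovariantRep.isIntegratedForm_ofRep`). Conversely a pair is read off from its integrated
form, since `U_x = π(α_x(1)) U_x` (`IsIntegratedForm.covariantRep_unique`). Everything is unital, so
non-degeneracy just means that the unit acts as the identity. -/

namespace EnvelopingCStar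

/-! ### Universal property of the enveloping C⋆-algebra -/

variable {B C : Type*} [NormedRing B] [StarRing B] [NormedAlgebra ℂ B]
  [CStarAlgebra C]

/-- The C⋆-identity of `C` pulls back along `φ`, which places `‖φ ·‖` among the seminorms whose
supremum is `maxNorm`. Contractivity has to be assumed because `B` need not be complete. -/
theorem isCStarSeminorm_comp_norm (φ : B →⋆ₙₐ[ℂ] C) (hφ : ∀ b, ‖φ b‖ ≤ ‖b‖) :
    IsCStarSeminorm ((normSeminorm ℂ C).comp (φ : B →ₗ[ℂ] C)) where
  mul_le a b := by
    change ‖φ (a * b)‖ ≤ ‖φ a‖ * ‖φ b‖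
    rw [map_mul]
    exact norm_mul_le _ _
  star_mul_self a := by
    change ‖φ (star a * a)‖ = ‖φ a‖ ^ 2
    rw [map_mul, map_star, CStarRing.norm_star_mul_self, sq]
  le_norm := hφ

theorem norm_le_maxNorm (φ : B →⋆ₙₐ[ℂ] C) (hφ : ∀ b, ‖φ b‖ ≤ ‖b‖) (b : B) :
    ‖φ b‖ ≤ maxNorm b :=
  le_maxNorm B ⟨_, isCStarSeminorm_comp_norm φ hφ⟩ b

variable [StarModule ℂ B]

/-- A contractive ⋆-homomorphism into a C⋆-algebra factors through the enveloping C⋆-algebra. -/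
theorem exists_lift (φ : B →⋆ₙₐ[ℂ] C) (hφ : ∀ b, ‖φ b‖ ≤ ‖b‖) :
    ∃ ρ : EnvelopingCStar B →⋆ₙₐ[ℂ] C, ∀ b, ρ (ι B b) = φ b := by
  -- On `Pre B` the norm is `maxNorm`, for which `φ` is still 1-Lipschitz; it therefore extends to
  -- the Hausdorff completion.
  let φ' : Pre B →+ C := (φ : B →+ C)
  have hu : UniformContinuous φ' :=
    (AddMonoidHomClass.lipschitz_of_bound φ' 1 fun b => by
      rw [one_mul]; exact norm_le_maxNorm φ hφ b).uniformContinuous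
  let F : EnvelopingCStar B → C := UniformSpace.Completion.extension φ'
  have hF : Continuous F := UniformSpace.Completion.continuous_extension
  have hof : ∀ b, F (of B b) = φ b := fun b => UniformSpace.Completion.extension_coe hu b
  have hs := continuous_star_aux B
  refine ⟨{ toFun := F, map_smul' := fun c a => ?_, map_zero' := ?_, map_add' := fun a b => ?_,
            map_mul' := fun a b => ?_, map_star' := fun a => ?_ }, hof⟩
  -- Each identity is a closed condition in each variable, so it suffices to check it on the dense
  -- image of `B`.
  · refine induct B (P := fun a => F (c • a) = c • F a)
      (isClosed_eq (hF.comp (continuous_const_smul c)) (hF.const_smul c)) (fun a => ?_) a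
    rw [← of_smul, hof, hof, map_smul]
  · rw [← of_zero, hof, map_zero]
  · refine induct B (P := fun a => F (a + b) = F a + F b)
      (isClosed_eq (hF.comp (continuous_add_const b)) (hF.add continuous_const)) (fun a => ?_) a
    refine induct B (P := fun b => F (of B a + b) = F (of B a) + F b)
      (isClosed_eq (hF.comp (continuous_const_add _)) (continuous_const.add hF)) (fun b => ?_) b
    rw [← of_add, hof, hof, hof, map_add]
  · refine induct B (P := fun a => F (a * b) = F a * F b)
      (isClosed_eq (hF.comp (continuous_mul_const b)) (hF.mul continuous_const)) (fun a => ?_) a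
    refine induct B (P := fun b => F (of B a * b) = F (of B a) * F b)
      (isClosed_eq (hF.comp (continuous_const_mul _)) (continuous_const.mul hF)) (fun b => ?_) b
    rw [← of_mul, hof, hof, hof, map_mul]
  · refine induct B (P := fun a => F (star a) = star (F a))
      (isClosed_eq (hF.comp hs) hF.star) (fun a => ?_) a
    rw [← of_star, hof, hof, map_star]

theorem continuous_starHom (ρ : EnvelopingCStar B →⋆ₙₐ[ℂ] C) : Continuous ρ :=
  AddMonoidHomClass.continuous_of_bound ρ 1 fun b => by
    rw [one_mul]; exact NonUnitalStarAlgHom.norm_apply_le ρ b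

/-- The image of `ι` is dense and ⋆-homomorphisms between C⋆-algebras are automatically continuous.
This gives the uniqueness of `π × U`. -/
theorem hom_ext {ρ ρ' : EnvelopingCStar B →⋆ₙₐ[ℂ] C} (h : ∀ b, ρ (ι B b) = ρ' (ι B b)) :
    ρ = ρ' :=
  NonUnitalStarAlgHom.ext fun a => induct B (P := fun a => ρ a = ρ' a)
    (isClosed_eq (continuous_starHom ρ) (continuous_starHom ρ')) h a

theorem continuous_ι : Continuous (ι B) :=
  AddMonoidHomClass.continuous_of_bound (ι B) 1 fun b => by
    rw [one_mul]; exact (norm_of B b).le.trans (maxNorm_le_norm B b)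

theorem ι_one : ι B 1 = 1 := rfl

end EnvelopingCStar

/-- Every `η = ρ 1 η` is itself one of the spanning vectors. Together with `IsNondegenerate.map_one`
this turns non-degeneracy into the equation `ρ 1 = 1`. -/
theorem isNondegenerate_of_map_one {B H : Type*} [Semiring B] [Star B] [Module ℂ B]
    [NormedAddCommGroup H] [InnerProductSpace ℂ H] [CompleteSpace H]
    {ρ : B →⋆ₙₐ[ℂ] (H →L[ℂ] H)} (h : ρ 1 = 1) : IsNondegenerate ρ := by
  have : Submodule.span ℂ {η : H | ∃ (b : B) (ξ : H), ρ b ξ = η} = ⊤ :=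
    eq_top_iff.mpr fun η _ => Submodule.subset_span ⟨1, η, by rw [h]; rfl⟩
  exact eq_top_iff.mpr (this.ge.trans (Submodule.le_topologicalClosure _))

/-! ### Linearity and norm estimates for the homogeneous terms -/

section HomogeneousTerm

variable {Γ A : Type*} [AddCommGroup Γ] [LinearOrder Γ] [CStarAlgebra A]
  {H : Type*} [NormedAddCommGroup H] [InnerProductSpace ℂ H] [CompleteSpace H]

theorem homogeneousTerm_add (π : A →⋆ₙₐ[ℂ] (H →L[ℂ] H)) (U : PosCone Γ → (H →L[ℂ] H)) (g : Γ)
    (a b : A) : homogeneousTerm π U g (a + b) =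
      homogeneousTerm π U g a + homogeneousTerm π U g b := by
  unfold homogeneousTerm
  split_ifs <;> simp only [map_add, add_mul, mul_add]

theorem homogeneousTerm_smul (π : A →⋆ₙₐ[ℂ] (H →L[ℂ] H)) (U : PosCone Γ → (H →L[ℂ] H)) (g : Γ)
    (c : ℂ) (a : A) : homogeneousTerm π U g (c • a) = c • homogeneousTerm π U g a := by
  unfold homogeneousTerm
  split_ifs <;> simp only [map_smul, smul_mul_assoc, mul_smul_comm]

theorem homogeneousTerm_zero (π : A →⋆ₙₐ[ℂ] (H →L[ℂ] H)) (U : PosCone Γ → (H →L[ℂ] H)) (g : Γ) :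
    homogeneousTerm π U g 0 = 0 := by
  simpa using homogeneousTerm_smul π U g 0 0

variable [IsOrderedAddMonoid Γ] {α : EndAction Γ A} {L : PosCone Γ → (A →L[ℂ] A)}
  {π : A →⋆ₙₐ[ℂ] (H →L[ℂ] H)} {U : PosCone Γ → (H →L[ℂ] H)}

/-- The element `p = α x 1` is a projection, so the C⋆-identity reads `‖p‖² = ‖p‖`. -/
theorem EndAction.norm_apply_one_le (α : EndAction Γ A) (x : PosCone Γ) : ‖α x 1‖ ≤ 1 := by
  have : ‖α x 1‖ * ‖α x 1‖ = ‖α x 1‖ := by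
    rw [← CStarRing.norm_star_mul_self, ← map_star, star_one, α.apply_mul_one]
  nlinarith [norm_nonneg (α x 1)]

theorem EndAction.apply_mem_coeffSpace (α : EndAction Γ A) (x : PosCone Γ) (a : A) :
    α x a ∈ coeffSpace α (x : Γ) := by
  rw [mem_coeffSpace_iff, Nonneg.toNonneg_coe, toNonneg_eq_zero (neg_nonpos.mpr x.2),
    α.zero_apply, one_mul, α.apply_mul_one]
  exact ⟨rfl, rfl⟩

theorem mem_coeffSpace_zero (α : EndAction Γ A) (a : A) : a ∈ coeffSpace α (0 : Γ) := by
  rw [mem_coeffSpace_iff, neg_zero, toNonneg_eq_zero le_rfl, α.zero_apply, one_mul, mul_one]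
  exact ⟨rfl, rfl⟩

/-- Not an axiom of transfer actions: it is the completeness identity at `x = 0`, where `α` is the
identity. -/
theorem IsCompleteTransferAction.zero_apply (hL : IsCompleteTransferAction α L) (a : A) :
    L 0 a = a := by
  have := hL.complete 0 a
  rwa [α.zero_apply, α.zero_apply, one_mul, mul_one] at this

namespace IsCovariant

/-- By covariance `U_x U_x^* = π(α_x(1))`, whose norm is at most one, and `‖U_x‖² = ‖U_x U_x^*‖`. -/
theorem norm_le_one (h : IsCovariant α L π U) (x : PosCone Γ) : ‖U x‖ ≤ 1 := by
  have h1 : ‖U x‖ * ‖U x‖ ≤ 1 := by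
    rw [← CStarRing.norm_self_mul_star, h.mul_star]
    exact (NonUnitalStarAlgHom.norm_apply_le π _).trans (α.norm_apply_one_le x)
  nlinarith [norm_nonneg (U x)]

/-- By `term_eq` the term is `π a` between two contractions, uniformly in the sign of `g`. This
bound makes the series for `π × U` converge absolutely. -/
theorem norm_term_le (h : IsCovariant α L π U) (g : Γ) (a : A) :
    ‖homogeneousTerm π U g a‖ ≤ ‖a‖ := by
  rw [h.term_eq]
  have h1 : ‖star (U (Nonneg.toNonneg (-g)))‖ ≤ 1 := by
    rw [norm_star]; exact h.norm_le_one _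
  have h2 := h.norm_le_one (Nonneg.toNonneg g)
  calc _ ≤ ‖star (U (Nonneg.toNonneg (-g)))‖ * ‖π a‖ * ‖U (Nonneg.toNonneg g)‖ := norm_mul₃_le
    _ ≤ 1 * ‖a‖ * 1 := by
      gcongr
      exact NonUnitalStarAlgHom.norm_apply_le π a
    _ = ‖a‖ := by ring

theorem term_zero (h : IsCovariant α L π U) (a : A) : homogeneousTerm π U 0 a = π a := by
  have := h.term_pos 0 a
  rwa [h.zero, mul_one] at this

/-- The chain `U_x = U_x π(1) = π(α_x(1)) U_x` exhibits `U_x` as the image of an admissible element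
of degree `x`; this is how `U` is recovered from `π × U`. -/
theorem term_apply_one (h : IsCovariant α L π U) (hL : IsCompleteTransferAction α L)
    (x : PosCone Γ) : homogeneousTerm π U (x : Γ) (α x 1) = U x := by
  rw [h.term_pos, ← h.mul_apply hL, h.nondegenerate.map_one, mul_one]

end IsCovariant

end HomogeneousTerm

section IntegratedForm

universe w u v t

variable {Γ : Type u} {A : Type v} [AddCommGroup Γ] [LinearOrder Γ] [IsOrderedAddMonoid Γ]
  [CStarAlgebra A] {α : EndAction Γ A} {hα : IsFinelyRepresentable.{w} α}
  {H : Type t} [NormedAddCommGroup H] [InnerProductSpace ℂ H] [CompleteSpace H]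

namespace L1

theorem hasSum_single (a : L1 hα) :
    HasSum (fun g => (single g (a.coeff g) (a.coeff_mem g) : L1 hα)) a :=
  lp.hasSum_single (p := 1) (by simp) (show lp (fun g : Γ => coeffSpace α g) 1 from a)

end L1

/-! ### Integrating a covariant representation -/

namespace CovariantRep

variable (R : CovariantRep hα H)

theorem summable_norm_term (a : L1 hα) :
    Summable fun g => ‖homogeneousTerm R.π R.U g (a.coeff g)‖ :=
  Summable.of_nonneg_of_le (fun _ => norm_nonneg _)
    (fun _ => R.isCovariant.norm_term_le _ _) a.summable_norm

/-- The sum `∑_{x>0} U_x^* π(a_{-x}) + π(a_0) + ∑_{x>0} π(a_x) U_x`. -/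
noncomputable def sumTerms (a : L1 hα) : H →L[ℂ] H :=
  ∑' g, homogeneousTerm R.π R.U g (a.coeff g)

theorem hasSum_sumTerms (a : L1 hα) :
    HasSum (fun g => homogeneousTerm R.π R.U g (a.coeff g)) (R.sumTerms a) :=
  (R.summable_norm_term a).of_norm.hasSum

/-- The contractivity that the passage to the enveloping algebra requires; it also gives the
continuity behind the density arguments. -/
theorem norm_sumTerms_le (a : L1 hα) : ‖R.sumTerms a‖ ≤ ‖a‖ := by
  refine (norm_tsum_le_tsum_norm (R.summable_norm_term a)).trans ?_
  rw [← a.hasSum_norm.tsum_eq]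
  exact (R.summable_norm_term a).tsum_le_tsum (fun _ => R.isCovariant.norm_term_le _ _)
    a.summable_norm

theorem sumTerms_add (a b : L1 hα) : R.sumTerms (a + b) = R.sumTerms a + R.sumTerms b := by
  refine HasSum.unique (R.hasSum_sumTerms (a + b)) ?_
  simp only [L1.coeff_add, homogeneousTerm_add]
  exact (R.hasSum_sumTerms a).add (R.hasSum_sumTerms b)

theorem sumTerms_smul (c : ℂ) (a : L1 hα) : R.sumTerms (c • a) = c • R.sumTerms a := by
  refine HasSum.unique (R.hasSum_sumTerms (c • a)) ?_
  simp only [L1.coeff_smul, homogeneousTerm_smul]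
  exact (R.hasSum_sumTerms a).const_smul c

theorem sumTerms_zero : R.sumTerms (0 : L1 hα) = 0 := by
  simpa using R.sumTerms_smul 0 0

theorem continuous_sumTerms : Continuous (R.sumTerms : L1 hα → H →L[ℂ] H) := by
  let f : L1 hα →+ (H →L[ℂ] H) :=
    { toFun := R.sumTerms, map_zero' := R.sumTerms_zero, map_add' := R.sumTerms_add }
  exact AddMonoidHomClass.continuous_of_bound f 1 fun a => by
    rw [one_mul]; exact R.norm_sumTerms_le a

theorem sumTerms_single (g : Γ) {a : A} (ha : a ∈ coeffSpace α g) :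
    R.sumTerms (L1.single g a ha : L1 hα) = homogeneousTerm R.π R.U g a := by
  unfold sumTerms
  rw [tsum_eq_single g, L1.coeff_single_self]
  intro k hk
  rw [L1.coeff_single_ne _ _ _ hk, homogeneousTerm_zero]

/-- Both sides are continuous and additive in each factor, so two uses of `L1.induct` reduce the
claim to `a δ_g` and `b δ_k`, where it is `IsCovariant.term_mul`. -/
theorem sumTerms_mul (a b : L1 hα) : R.sumTerms (a * b) = R.sumTerms a * R.sumTerms b := by
  have hc := R.continuous_sumTerms
  refine L1.induct (P := fun a => R.sumTerms (a * b) = R.sumTerms a * R.sumTerms b)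
    (isClosed_eq (hc.comp (continuous_mul_const b)) (hc.mul continuous_const))
    (by simp only [zero_mul, R.sumTerms_zero])
    (fun a a' h h' => by simp only [add_mul, R.sumTerms_add, h, h']) (fun g a ha => ?_) a
  refine L1.induct (P := fun b => R.sumTerms (L1.single g a ha * b) =
      R.sumTerms (L1.single g a ha) * R.sumTerms b)
    (isClosed_eq (hc.comp (continuous_const_mul _)) (continuous_const.mul hc))
    (by simp only [mul_zero, R.sumTerms_zero])
    (fun b b' h h' => by simp only [mul_add, R.sumTerms_add, h, h']) (fun k b hb => ?_) b
  rw [L1.single_mul_single, sumTerms_single, sumTerms_single, sumTerms_single,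
    R.isCovariant.term_mul hα.isComplete_transfer g k ha hb]

theorem sumTerms_star (a : L1 hα) : R.sumTerms (star a) = star (R.sumTerms a) := by
  have hc := R.continuous_sumTerms
  refine L1.induct (P := fun a => R.sumTerms (star a) = star (R.sumTerms a))
    (isClosed_eq (hc.comp continuous_star) hc.star)
    (by simp only [star_zero, R.sumTerms_zero])
    (fun a a' h h' => by simp only [star_add, R.sumTerms_add, h, h']) (fun g a ha => ?_) a
  rw [L1.star_single, sumTerms_single, sumTerms_single, R.isCovariant.term_star]

/-- The ⋆-representation of `l₁(Γ, α, A)` given by a covariant representation. -/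
noncomputable def l1Rep : L1 hα →⋆ₙₐ[ℂ] (H →L[ℂ] H) where
  toFun := R.sumTerms
  map_smul' := R.sumTerms_smul
  map_zero' := R.sumTerms_zero
  map_add' := R.sumTerms_add
  map_mul' := R.sumTerms_mul
  map_star' := R.sumTerms_star

theorem existsUnique_isIntegratedForm :
    ∃! ρ : CrossedProduct hα →⋆ₙₐ[ℂ] (H →L[ℂ] H), IsIntegratedForm R ρ := by
  obtain ⟨ρ, hρ⟩ := EnvelopingCStar.exists_lift R.l1Rep R.norm_sumTerms_le
  refine ⟨ρ, fun a => ?_, fun ρ' h => EnvelopingCStar.hom_ext fun a => ?_⟩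
  · rw [hρ]; exact R.hasSum_sumTerms a
  · rw [hρ]; exact (h a).unique (R.hasSum_sumTerms a)

end CovariantRep

/-! ### Recovering the pair from its integrated form -/

namespace IsIntegratedForm

variable {R : CovariantRep hα H} {ρ : CrossedProduct hα →⋆ₙₐ[ℂ] (H →L[ℂ] H)}

theorem apply_single (h : IsIntegratedForm R ρ) (g : Γ) {a : A} (ha : a ∈ coeffSpace α g) :
    ρ (EnvelopingCStar.ι (L1 hα) (L1.single g a ha)) = homogeneousTerm R.π R.U g a := by
  rw [← R.sumTerms_single g ha]
  exact (h _).unique (R.hasSum_sumTerms _)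

/-- The unit of the crossed product is the class of `1 δ_0`, which acts as `π(1) = 1`. -/
theorem isNondegenerate (h : IsIntegratedForm R ρ) : IsNondegenerate ρ := by
  apply isNondegenerate_of_map_one
  rw [← EnvelopingCStar.ι_one, L1.one_def, h.apply_single, R.isCovariant.term_zero,
    R.isCovariant.nondegenerate.map_one]

/-- Necessarily `π(a)` is the value of `ρ` at `a δ_0` and `U_x` its value at `α_x(1) δ_x`. -/
theorem covariantRep_unique {R' : CovariantRep hα H} (h : IsIntegratedForm R ρ)
    (h' : IsIntegratedForm R' ρ) : R = R' := by
  have hπ : R.π = R'.π := NonUnitalStarAlgHom.ext fun a => by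
    rw [← R.isCovariant.term_zero, ← R'.isCovariant.term_zero,
      ← h.apply_single 0 (mem_coeffSpace_zero α a), ← h'.apply_single]
  have hU : R.U = R'.U := funext fun x => by
    rw [← R.isCovariant.term_apply_one hα.isComplete_transfer,
      ← R'.isCovariant.term_apply_one hα.isComplete_transfer,
      ← h.apply_single _ (α.apply_mem_coeffSpace x 1), ← h'.apply_single]
  cases R; cases R'
  simp only at hπ hU
  subst hπ hU
  rfl

end IsIntegratedForm

/-! ### Covariance relations inside `l₁(Γ, α, A)` -/

namespace L1

variable (hα) in
/-- The canonical copy of `A` in degree zero. -/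
noncomputable def baseHom : A →⋆ₙₐ[ℂ] L1 hα where
  toFun a := single 0 a (mem_coeffSpace_zero α a)
  map_smul' c a := by
    ext g
    by_cases hg : g = 0
    · subst hg; simp [coeff_single_self]
    · simp [coeff_single_ne _ _ _ hg]
  map_zero' := by
    ext g
    by_cases hg : g = 0
    · subst hg; simp [coeff_single_self]
    · simp [coeff_single_ne _ _ _ hg]
  map_add' a b := by
    ext g
    by_cases hg : g = 0
    · subst hg; simp [coeff_single_self]
    · simp [coeff_single_ne _ _ _ hg]
  map_mul' a b := by
    rw [single_mul_single]
    refine single_congr (add_zero 0).symm ?_ _ _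
    unfold mulCoeff
    rw [if_pos le_rfl, if_pos le_rfl, toNonneg_eq_zero le_rfl, α.zero_apply]
  map_star' a := by
    rw [star_single]
    exact single_congr neg_zero.symm rfl _ _

variable (hα) in
/-- The element `α_x(1) δ_x`. -/
noncomputable def shift (x : PosCone Γ) : L1 hα :=
  single (x : Γ) (α x 1) (α.apply_mem_coeffSpace x 1)

theorem shift_add (x y : PosCone Γ) : shift hα (x + y) = shift hα x * shift hα y := by
  unfold shift
  rw [single_mul_single]
  refine single_congr (Nonneg.coe_add x y) ?_ _ _
  unfold mulCoeff
  rw [if_pos x.2, if_pos y.2, Nonneg.toNonneg_coe, ← map_mul, one_mul, α.add_apply]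

/-- The product has coefficient `a α_x(1)`, which is `a` exactly because `a` is admissible in degree
`x`. So degree zero and the shifts generate all non-negative degrees. -/
theorem baseHom_mul_shift (x : PosCone Γ) {a : A} (ha : a ∈ coeffSpace α (x : Γ)) :
    baseHom hα a * shift hα x = single (x : Γ) a ha := by
  change single 0 a _ * single (x : Γ) (α x 1) _ = _
  rw [single_mul_single]
  refine single_congr (zero_add _) ?_ _ _
  rw [mem_coeffSpace_iff, Nonneg.toNonneg_coe] at ha
  unfold mulCoeff
  rw [if_pos le_rfl, if_pos x.2, toNonneg_eq_zero le_rfl, α.zero_apply, ha.2]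

theorem shift_mul_baseHom (x : PosCone Γ) (a : A) :
    shift hα x * baseHom hα a = single (x : Γ) (α x a) (α.apply_mem_coeffSpace x a) := by
  change single (x : Γ) (α x 1) _ * single 0 a _ = _
  rw [single_mul_single]
  refine single_congr (add_zero _) ?_ _ _
  unfold mulCoeff
  rw [if_pos x.2, if_pos le_rfl, Nonneg.toNonneg_coe, α.one_mul_apply]

/-- The adjoint of `baseHom_mul_shift` for `star a`; it covers the degrees `-x`. -/
theorem star_shift_mul_baseHom (x : PosCone Γ) {a : A} (ha : a ∈ coeffSpace α (-(x : Γ))) :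
    star (shift hα x) * baseHom hα a = single (-(x : Γ)) a ha := by
  have h := congrArg star (baseHom_mul_shift (hα := hα) x
    (by simpa using star_mem_coeffSpace ha))
  rw [star_mul, ← map_star, star_star, star_single] at h
  rw [h]
  exact single_congr rfl (star_star a) _ _

theorem shift_mul_baseHom_mul_star_shift (x : PosCone Γ) (a : A) :
    shift hα x * baseHom hα a * star (shift hα x) = baseHom hα (α x a) := by
  rw [shift_mul_baseHom]
  change _ * star (single (x : Γ) (α x 1) _) = single 0 (α x a) _
  rw [star_single, single_mul_single]
  refine single_congr (add_neg_cancel _) ?_ _ _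
  rw [← map_star, star_one]
  unfold mulCoeff
  rw [if_pos x.2]
  split_ifs with h1 h2
  -- The second degree `-x` is non-negative only for `x = 0`, where `mulCoeff` uses a different
  -- branch.
  · obtain rfl : x = 0 := le_antisymm (Subtype.coe_le_coe.mp (neg_nonneg.mp h1)) x.2
    rw [Nonneg.toNonneg_coe, α.zero_apply, α.zero_apply, α.zero_apply, mul_one]
  · rw [add_neg_cancel, toNonneg_eq_zero le_rfl, α.zero_apply, α.apply_mul_one]
  · exact absurd (add_neg_cancel (x : Γ)).ge h2

/-- For `x > 0` a product of degrees `-x` and `x` is defined through `L_x`, and `L_x` does not see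
the factors `α_x(1)` on either side of `a`. -/
theorem star_shift_mul_baseHom_mul_shift (x : PosCone Γ) (a : A) :
    star (shift hα x) * baseHom hα a * shift hα x = baseHom hα (hα.transfer x a) := by
  have hL := hα.isComplete_transfer
  -- An arbitrary `a` need not be admissible in degree `-x`, but `α_x(1) a` is, and the adjoint of
  -- the shift absorbs the projection.
  have h1 : star (shift hα x) * baseHom hα a = star (shift hα x) * baseHom hα (α x 1 * a) := by
    have : star (shift hα x) = star (shift hα x) * baseHom hα (α x 1) := by
      have h := congrArg star (baseHom_mul_shift (hα := hα) x (α.apply_mem_coeffSpace x 1))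
      rw [star_mul, ← map_star, ← map_star, star_one] at h
      exact h.symm
    rw [map_mul, ← mul_assoc, ← this]
  have ha : α x 1 * a ∈ coeffSpace α (-(x : Γ)) := by
    rw [mem_coeffSpace_iff, neg_neg, Nonneg.toNonneg_coe,
      toNonneg_eq_zero (neg_nonpos.mpr x.2), α.zero_apply, mul_one, ← mul_assoc,
      α.apply_mul_one]
    exact ⟨rfl, rfl⟩
  rw [h1, star_shift_mul_baseHom x ha]
  change _ * single (x : Γ) (α x 1) _ = single 0 (hα.transfer x a) _
  rw [single_mul_single]
  refine single_congr (neg_add_cancel _) ?_ _ _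
  unfold mulCoeff
  -- At `x = 0` the branch of `mulCoeff` does not involve `L`, so the fact that `L_0` is the
  -- identity is needed there.
  obtain rfl | hx := eq_or_ne x 0
  · have h0 : -((0 : PosCone Γ) : Γ) = 0 := neg_zero
    rw [h0, if_pos le_rfl, if_pos (0 : PosCone Γ).2, toNonneg_eq_zero le_rfl, α.zero_apply,
      α.zero_apply, hL.zero_apply, one_mul, mul_one]
  · have hpos : (0 : Γ) < x := lt_of_le_of_ne x.2 fun h => hx (Subtype.ext h.symm)
    rw [if_neg (not_le.mpr (neg_neg_of_pos hpos)), if_neg (not_le.mpr hpos),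
      if_pos (neg_add_cancel _).ge, neg_neg, Nonneg.toNonneg_coe, hL.apply_mul_one,
      hL.apply_one_mul]

end L1

/-! ### Restricting representations, and the bijection -/

/-- The covariant representation obtained by restricting a non-degenerate representation of the
crossed product. -/
noncomputable def CovariantRep.ofRep (ρ : CrossedProduct hα →⋆ₙₐ[ℂ] (H →L[ℂ] H))
    (hρ : IsNondegenerate ρ) : CovariantRep hα H where
  π := (ρ.comp (EnvelopingCStar.ι (L1 hα))).comp (L1.baseHom hα)
  U x := ρ (EnvelopingCStar.ι (L1 hα) (L1.shift hα x))
  isCovariant :=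
    -- The copy of `1` in degree zero is by definition the unit of `l₁(Γ, α, A)`, so `π 1` unfolds
    -- to `ρ 1`.
    { nondegenerate := isNondegenerate_of_map_one hρ.map_one
      add := fun x y => by rw [L1.shift_add, map_mul, map_mul]
      conj := fun x a => by
        simp only [NonUnitalStarAlgHom.comp_apply]
        rw [← L1.shift_mul_baseHom_mul_star_shift]
        simp only [map_mul, map_star]
      star_conj := fun x a => by
        simp only [NonUnitalStarAlgHom.comp_apply]
        rw [← L1.star_shift_mul_baseHom_mul_shift]
        simp only [map_mul, map_star] }

/-- The norm convergent expansion `a = ∑ a_g δ_g` is preserved by the continuous map `ρ ∘ ι`, and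
each `a_g δ_g` factors through degree zero and a shift or the adjoint of one. -/
theorem CovariantRep.isIntegratedForm_ofRep (ρ : CrossedProduct hα →⋆ₙₐ[ℂ] (H →L[ℂ] H))
    (hρ : IsNondegenerate ρ) : IsIntegratedForm (CovariantRep.ofRep ρ hρ) ρ := by
  intro a
  have h := a.hasSum_single.map (ρ.comp (EnvelopingCStar.ι (L1 hα)))
    ((EnvelopingCStar.continuous_starHom ρ).comp EnvelopingCStar.continuous_ι)
  refine cast (congrArg (fun f => HasSum f _) (funext fun g => Eq.symm ?_)) h
  have hg := a.coeff_mem g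
  change _ = ρ (EnvelopingCStar.ι (L1 hα) (L1.single g (a.coeff g) hg))
  generalize a.coeff g = b at hg
  rcases le_total 0 g with h0 | h0
  · obtain ⟨x, rfl⟩ : ∃ x : PosCone Γ, g = x := ⟨⟨g, h0⟩, rfl⟩
    rw [(ofRep ρ hρ).isCovariant.term_pos, ← L1.baseHom_mul_shift, map_mul, map_mul]
    rfl
  · obtain ⟨x, rfl⟩ : ∃ x : PosCone Γ, g = -(x : Γ) :=
      ⟨⟨-g, neg_nonneg.mpr h0⟩, (neg_neg g).symm⟩
    rw [(ofRep ρ hρ).isCovariant.term_neg, ← L1.star_shift_mul_baseHom, map_mul, map_mul,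
      map_star, map_star]
    rfl

/-- The bijection `(π, U) ↦ π × U`. -/
noncomputable def CovariantRep.equivRep (hα : IsFinelyRepresentable.{w} α) (H : Type t)
    [NormedAddCommGroup H] [InnerProductSpace ℂ H] [CompleteSpace H] :
    CovariantRep hα H ≃ {ρ : CrossedProduct hα →⋆ₙₐ[ℂ] (H →L[ℂ] H) // IsNondegenerate ρ} where
  toFun R := ⟨R.existsUnique_isIntegratedForm.choose,
    IsIntegratedForm.isNondegenerate R.existsUnique_isIntegratedForm.choose_spec.1⟩
  invFun ρ := CovariantRep.ofRep ρ.1 ρ.2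
  -- `R` and the restriction of its integrated form have the same integrated form, hence coincide.
  left_inv R := (CovariantRep.isIntegratedForm_ofRep _ _).covariantRep_unique
    R.existsUnique_isIntegratedForm.choose_spec.1
  -- `ρ` is an integrated form of its own restriction, and integrated forms are unique.
  right_inv ρ := Subtype.ext ((CovariantRep.ofRep ρ.1 ρ.2).existsUnique_isIntegratedForm.unique
    (CovariantRep.ofRep ρ.1 ρ.2).existsUnique_isIntegratedForm.choose_spec.1
    (CovariantRep.isIntegratedForm_ofRep ρ.1 ρ.2))

end IntegratedForm

theorem corollary5p5 {Γ A : Type*} [AddCommGroup Γ] [LinearOrder Γ] [IsOrderedAddMonoid Γ]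
    [CStarAlgebra A] (α : EndAction Γ A) (hα : IsFinelyRepresentable α)
    (H : Type*) [NormedAddCommGroup H] [InnerProductSpace ℂ H] [CompleteSpace H] :
    (∀ R : CovariantRep hα H,
      ∃! ρ : CrossedProduct hα →⋆ₙₐ[ℂ] (H →L[ℂ] H), IsIntegratedForm R ρ) ∧
    ∃ Φ : CovariantRep hα H ≃ {ρ : CrossedProduct hα →⋆ₙₐ[ℂ] (H →L[ℂ] H) // IsNondegenerate ρ},
      ∀ R : CovariantRep hα H, IsIntegratedForm R (Φ R).1 :=
  ⟨fun R => R.existsUnique_isIntegratedForm, CovariantRep.equivRep hα H,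
    fun R => R.existsUnique_isIntegratedForm.choose_spec.1⟩
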